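/- **Model.** A network has $n$ users in the unit square and a library of $m\ge 1$ independent, uniformly distributed files of $F$ bits. Each user caches at most $MF$ bits and requests one file. Links follow the protocol model with range $r>0$ and guard parameter $\Delta>0$: the link $u\to v$ can be active if $v$ is within distance $r$ of $u$ and at distance at least $(1+\Delta)r$ from every other active transmitter. An active link carries $C_r>0$ bits per channel use, and one transmission can serve several receivers. A user transmits a function of its cache and the demands. A scheme achieves transmission rate $R$ and per-user throughput $T$ with cache size $M$ if for every $\varepsilon>0$, along a sequence of file sizes $F\to\infty$, the total number of coded bits is at most $(R+o(1))F$, the worst-case error probability over demands and users has $\limsup\le\varepsilon$, and all messages are delivered by a feasible transmission policy in $D$ channel uses with $\limsup_{F\to\infty} DT/F\le 1$. **RS-graph scheme.** Let $G$ be a $(\gamma,\tau)$-Ruzsa–Szemerédi graph on the $n$ users, i.e. its edge set is a union of $\tau\ge1$ pairwise disjoint induced matchings with $\gamma\ge1$ edges each. Each file is cut into $K=(2\gamma-1)n$ packets, $2\gamma-1$ for each vertex. A user caches, from all files, the packets of all vertices not adjacent to it (its own included). In each matching, each node $v$ with partner $w$ is to receive the $2\gamma-1$ packets of $w$ of its requested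 file, one from each of the other $2\gamma-1$ nodes of the matching, according to a fixed assignment of distinct packets to distinct nodes; each node multicasts the XOR of the $2\gamma-1$ packets so assigned to it. **Statement.** Let $r\ge\sqrt2$ and $R^{\rm RS}=\frac{\tau}{n}\cdot\frac{2\gamma}{2\gamma-1}$. (1) If every vertex of $G$ has degree at least $n-nM/m$, then the RS-graph scheme built on $G$ (with any packet assignment) achieves, with cache size $M$, the transmission rate $R^{\rm RS}$ and the per-user throughput $$T^{\rm RS}=\frac{C_r}{R^{\rm RS}} .$$ (2) Let $\Lambda>10.5^2$ be an integer, $\delta=\frac{2\ln 10.5}{\ln\Lambda}$, and let $n=\Lambda^z$ with $z\to\infty$. There are $(\gamma_z,\tau_z)$-Ruzsa–Szemerédi graphs on $n=\Lambda^z$ vertices, $z\ge 2\Lambda$, which satisfy the degree condition of (1) for the cache size $M=2mn^{-\frac{1}{2\Lambda^4\ln\Lambda}}$ (for every $m$), for which the scheme therefore achieves $T^{\rm RS}=C_r/R^{\rm RS}$, whose number of packets per file is $K=(2\gamma_z-1)n=O(n^{2-\delta})$, and for which, as $n\to\infty$, $$T^{\rm RS}=\frac{C_r}{R^{\rm RS}}=C_r\,n^{-\delta}+o(n^{-\delta}).$$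 In particular, when the link rate for $r\ge\sqrt2$ is $C_r=C_{\sqrt2}$, this is $C_{\sqrt2}\,n^{-\delta}+o(n^{-\delta})$. -/

import Mathlib

open Filter Asymptotics

/-- The protocol model: transmission range `r`, guard parameter `Δ`, and the link rate `C_r`
(in bits per channel use) as a function of the range. -/
structure ProtocolModel where
  range : ℝ
  guard : ℝ
  linkRate : ℝ → ℝ
  range_pos : 0 < range
  guard_pos : 0 < guard
  linkRate_pos : ∀ r, 0 < r → 0 < linkRate r

/-- A set `A` of directed links (transmitter, receiver) can be active simultaneously: each receiver
is within range of its transmitter and at least `(1 + Δ) r` away from every other active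
transmitter.  Several links with the same transmitter form a multicast. -/
def ProtocolModel.FeasibleLinks (P : ProtocolModel) {n : ℕ}
    (pos : Fin n → EuclideanSpace ℝ (Fin 2)) (A : Set (Fin n × Fin n)) : Prop :=
  ∀ l ∈ A, dist (pos l.1) (pos l.2) ≤ P.range ∧
    ∀ k ∈ A, k.1 ≠ l.1 → (1 + P.guard) * P.range ≤ dist (pos l.2) (pos k.1)

/-- All users lie in the unit square. -/
def InUnitSquare {n : ℕ} (pos : Fin n → EuclideanSpace ℝ (Fin 2)) : Prop :=
  ∀ u i, 0 ≤ pos u i ∧ pos u i ≤ 1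

/-- Cache placement and coded delivery functions for `n` users and a library of `m` files.
A file is a vector of bits indexed by the finite type `fileBit`; the cache of user `u` and its
transmitted message are vectors of bits indexed by `cacheBit u` and `msgBit u`. -/
structure D2DCode (n m : ℕ) where
  fileBit : Type
  cacheBit : Fin n → Type
  msgBit : Fin n → Type
  finite_fileBit : Finite fileBit
  finite_cacheBit : ∀ u, Finite (cacheBit u)
  finite_msgBit : ∀ u, Finite (msgBit u)
  place : ∀ u, (Fin m → fileBit → ZMod 2) → cacheBit u → ZMod 2
  encode : ∀ u, (cacheBit u → ZMod 2) → (Fin n → Fin m) → msgBit u → ZMod 2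

namespace D2DCode

variable {n m : ℕ}

/-- The file size `F` in bits. -/
noncomputable def fileSize (c : D2DCode n m) : ℕ := Nat.card c.fileBit

/-- The number of coded bits transmitted by user `u`. -/
noncomputable def msgSize (c : D2DCode n m) (u : Fin n) : ℕ := Nat.card (c.msgBit u)

/-- Every user caches at most `M F` bits. -/
def FitsMemory (c : D2DCode n m) (M : ℝ) : Prop :=
  ∀ u, (Nat.card (c.cacheBit u) : ℝ) ≤ M * c.fileSize

/-- The transmission rate `R = ∑ u, R_u`, where `R_u` is the number of bits sent by `u` over `F`. -/
noncomputable def rate (c : D2DCode n m) : ℝ :=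
  (∑ u, (c.msgSize u : ℝ)) / c.fileSize

/-- The message of user `u` for the library `W` and the demand vector `d`. -/
def message (c : D2DCode n m) (W : Fin m → c.fileBit → ZMod 2) (d : Fin n → Fin m) (u : Fin n) :
    c.msgBit u → ZMod 2 :=
  c.encode u (c.place u W) d

end D2DCode

/-- A transmission policy: the set of active links in each of finitely many channel uses. -/
structure TransmissionPolicy (n : ℕ) where
  channelUses : ℕ
  active : Fin channelUses → Set (Fin n × Fin n)

/-- The users whose message is received by `u`: the link to `u` is active in enough channel uses to
carry the whole message at rate `C_r`. -/
def TransmissionPolicy.received {n m : ℕ} (π : TransmissionPolicy n) (P : ProtocolModel)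
    (c : D2DCode n m) (u : Fin n) : Set (Fin n) :=
  {v | (c.msgSize v : ℝ) ≤
    P.linkRate P.range * ({s : Fin π.channelUses | (v, u) ∈ π.active s}.ncard : ℝ)}

/-- A transmission policy with decoding functions; user `u` decodes from the messages it receives,
its own cache and the demand vector. -/
structure Delivery {n m : ℕ} (P : ProtocolModel) (c : D2DCode n m) where
  policy : TransmissionPolicy n
  decode : ∀ u : Fin n, (∀ v : policy.received P c u, c.msgBit v → ZMod 2) →
    (c.cacheBit u → ZMod 2) → (Fin n → Fin m) → c.fileBit → ZMod 2

namespace Delivery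

variable {n m : ℕ} {P : ProtocolModel} {c : D2DCode n m}

/-- The policy obeys the protocol model in every channel use. -/
def Feasible (E : Delivery P c) (pos : Fin n → EuclideanSpace ℝ (Fin 2)) : Prop :=
  ∀ s, P.FeasibleLinks pos (E.policy.active s)

/-- What user `u` decodes. -/
def decoded (E : Delivery P c) (W : Fin m → c.fileBit → ZMod 2) (d : Fin n → Fin m) (u : Fin n) :
    c.fileBit → ZMod 2 :=
  E.decode u (fun v => c.message W d v) (c.place u W) d

/-- Worst-case error probability over demands and users, for independent uniform files. -/
noncomputable def errorProb (E : Delivery P c) : ℝ :=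
  ⨆ d : Fin n → Fin m, ⨆ u : Fin n,
    (({W : Fin m → c.fileBit → ZMod 2 | E.decoded W d u ≠ W (d u)}.ncard : ℝ) /
      (Nat.card (Fin m → c.fileBit → ZMod 2) : ℝ))

end Delivery

/-- With cache size `M`, the codes in `𝒞` achieve transmission rate `R` and per-user throughput `T`:
for every `ε > 0` there are codes in `𝒞`, decoders and feasible transmission policies along file
sizes `F → ∞` with `limsup R⁽ᶠ⁾ ≤ R`, `limsup P_e⁽ᶠ⁾ ≤ ε`, and a number `D` of channel uses with
`limsup D T / F ≤ 1`. -/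
def AchievedBy {n m : ℕ} (P : ProtocolModel) (pos : Fin n → EuclideanSpace ℝ (Fin 2))
    (𝒞 : Set (D2DCode n m)) (M R T : ℝ) : Prop :=
  ∀ ε : ℝ, 0 < ε → ∃ (c : ℕ → D2DCode n m) (E : ∀ k, Delivery P (c k)),
    (∀ k, c k ∈ 𝒞) ∧
    Tendsto (fun k => (c k).fileSize) atTop atTop ∧
    (∀ k, (c k).FitsMemory M) ∧
    (∀ k, (E k).Feasible pos) ∧
    (∀ η : ℝ, 0 < η → ∀ᶠ k in atTop, (c k).rate ≤ R + η) ∧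
    (∀ η : ℝ, 0 < η → ∀ᶠ k in atTop, (E k).errorProb ≤ ε + η) ∧
    (∀ η : ℝ, 0 < η → ∀ᶠ k in atTop,
      ((E k).policy.channelUses : ℝ) * T ≤ (1 + η) * (c k).fileSize)

/-- `G` is a `(γ, τ)`-Ruzsa-Szemerédi graph through the matchings `𝓜`: its edge set is the union of
`τ` pairwise disjoint induced matchings with `γ` edges each. -/
structure IsRSDecomposition {n τ : ℕ} (G : SimpleGraph (Fin n)) (γ : ℕ)
    (𝓜 : Fin τ → G.Subgraph) : Prop where
  isMatching : ∀ i, (𝓜 i).IsMatching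
  isInduced : ∀ i, (𝓜 i).IsInduced
  card_edges : ∀ i, (𝓜 i).edgeSet.ncard = γ
  disjoint : ∀ i j, i ≠ j → Disjoint (𝓜 i).edgeSet (𝓜 j).edgeSet
  cover : ⋃ i, (𝓜 i).edgeSet = G.edgeSet

/-- For a node `v` of the matching `𝓜 i`, the numbers `lab i v w` distribute the `2γ - 1` packets
which `v` wants in this matching among the `2γ - 1` other nodes `w`: distinct nodes get distinct
packets. -/
def IsPacketAssignment {n τ γ : ℕ} {G : SimpleGraph (Fin n)} (𝓜 : Fin τ → G.Subgraph)
    (lab : Fin τ → Fin n → Fin n → Fin (2 * γ - 1)) : Prop :=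
  ∀ i, ∀ v ∈ (𝓜 i).verts, Set.InjOn (lab i v) ((𝓜 i).verts \ {v})

open Classical in
/-- The Ruzsa-Szemerédi graph scheme with packets of `B` bits.  A file has `K = n (2γ - 1)` packets,
`2γ - 1` for each vertex.  User `u` caches, from all files, the packets of every vertex not adjacent
to `u` (hence also those of `u` itself).  In each matching containing `u`, user `u` sends the XOR,
over the other nodes `v` of the matching, of packet number `lab i v u` of the partner `w` of `v`,
taken from the file requested by `v`.  (The value `0` for a packet that is not cached is never used
when the matchings are induced.) -/
noncomputable def rsCode {n τ : ℕ} {G : SimpleGraph (Fin n)} (𝓜 : Fin τ → G.Subgraph) (γ : ℕ)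
    (lab : Fin τ → Fin n → Fin n → Fin (2 * γ - 1)) (m B : ℕ) : D2DCode n m where
  fileBit := (Fin n × Fin (2 * γ - 1)) × Fin B
  cacheBit u := {q : Fin m × ((Fin n × Fin (2 * γ - 1)) × Fin B) // ¬ G.Adj u q.2.1.1}
  msgBit u := {i : Fin τ // u ∈ (𝓜 i).verts} × Fin B
  finite_fileBit := inferInstance
  finite_cacheBit _ := inferInstance
  finite_msgBit _ := inferInstance
  place _ W q := W q.1.1 q.1.2
  encode u Z d p :=
    ∑ v : Fin n, ∑ w : Fin n,
      if v ≠ u ∧ (𝓜 p.1).Adj v w then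
        (if h : ¬ G.Adj u w then Z ⟨(d v, ((w, lab p.1 v u), p.2)), h⟩ else 0)
      else 0

/-- The transmission rate `(τ / n) · 2γ / (2γ - 1)`. -/
noncomputable def rsRate (n γ τ : ℕ) : ℝ :=
  (τ : ℝ) / n * (2 * γ / (2 * γ - 1))

/-- The exponent `δ = 2 ln 10.5 / ln Λ`. -/
noncomputable def rsDelta (Λ : ℕ) : ℝ := 2 * Real.log 10.5 / Real.log Λ

/-- The cache size `M = 2 m n ^ (-1 / (2 Λ⁴ ln Λ))` for `n = Λ ^ z` users. -/
noncomputable def rsMemory (Λ z m : ℕ) : ℝ :=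
  2 * m * ((Λ : ℝ) ^ z) ^ (-(1 / (2 * (Λ : ℝ) ^ 4 * Real.log Λ)))

/-! The scheme decodes because the matchings are induced. Suppose u lacks a packet of its neighbour
w, and uw lies in a matching. Any third node x of that matching is not adjacent to w, so x has the
packet and can send it. Every other packet in the XOR sent by x belongs to the partner w' of some v
different from u; this w' is not adjacent to u, so u can cancel it (`rsCode_determines`). When r ≥
√2 everybody hears everybody, and time sharing delivers all messages at the cost of rounding, which
vanishes relative to F.

For the asymptotic part the graph is a Cayley graph of the torus (ℤ/Λ)^z. Its differences are taken
from the shell of vectors whose squared length is within z/2 of the mean. By a Chernoff bound the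
shell is almost the whole group. Each difference d is represented by an edge {a d, b d} near the
origin with a d ≈ -d/2 and b d ≈ d/2. Such edges rarely conflict: if endpoints p, p' of two of them
are adjacent, the parallelogram law makes |p + p'|² at most 3z, so p' lies in a small ball around
-p. That ball has at most 24^z points, and p' determines its difference up to 3^z roundings and a
sign. This gives at most 8·72^z conflicts per edge (`exists_edges_few_conflicts`).

A greedy choice then cuts almost all differences, one from each pair ±d, into q = ⌈10.5^(2z)⌉
conflict-free classes of equal size γ. Each class is an induced matching, and its n translates are
edge-disjoint, so there are τ = nq matchings (`isRSDecomposition_cayleyGraph`). Since 72 < 10.5² <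
Λ, the discarded differences are negligible and γ → ∞. Hence the rate is q · 2γ/(2γ-1), which is
asymptotic to 10.5^(2z) = n^δ. -/

/-- A finite matching covers twice as many vertices as it has edges. -/
theorem SimpleGraph.Subgraph.IsMatching.ncard_verts {V : Type*} [Finite V] {G : SimpleGraph V}
    {M : G.Subgraph} (h : M.IsMatching) : M.verts.ncard = 2 * M.edgeSet.ncard := by
  classical
  have := Fintype.ofFinite V
  rw [← Nat.card_coe_set_eq, ← Nat.card_coe_set_eq, Nat.card_eq_fintype_card,
    Nat.card_eq_fintype_card, ← Finset.card_univ, ← Finset.card_univ]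
  rw [Finset.card_eq_sum_card_fiberwise (f := h.toEdge) (t := Finset.univ) (fun _ _ => by simp)]
  rw [Finset.sum_const_nat (m := 2), mul_comm]
  rintro ⟨e, he⟩ -
  induction e with | _ u v =>
  have hadj : M.Adj u v := he
  have hf := h.toEdge_preimage_singleton hadj
  have : (Finset.univ.filter fun a => h.toEdge a = ⟨s(u, v), he⟩) =
      {⟨u, hadj.fst_mem⟩, ⟨v, hadj.snd_mem⟩} := by
    ext a
    have := Set.ext_iff.1 hf a
    simpa using this
  rw [this, Finset.card_pair]
  intro heq
  exact hadj.ne (congrArg Subtype.val heq)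

theorem IsRSDecomposition.ncard_verts {n τ γ : ℕ} {G : SimpleGraph (Fin n)}
    {𝓜 : Fin τ → G.Subgraph} (h : IsRSDecomposition G γ 𝓜) (i : Fin τ) :
    (𝓜 i).verts.ncard = 2 * γ := by
  rw [(h.isMatching i).ncard_verts, h.card_edges]

/-- A packet assignment is onto: every packet wanted by `v` is assigned to another node. -/
theorem IsPacketAssignment.exists_eq {n τ γ : ℕ} {G : SimpleGraph (Fin n)}
    {𝓜 : Fin τ → G.Subgraph} (h : IsRSDecomposition G γ 𝓜)
    {lab : Fin τ → Fin n → Fin n → Fin (2 * γ - 1)} (hlab : IsPacketAssignment 𝓜 lab)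
    {i : Fin τ} {v : Fin n} (hv : v ∈ (𝓜 i).verts) (j : Fin (2 * γ - 1)) :
    ∃ x ∈ (𝓜 i).verts, x ≠ v ∧ lab i v x = j := by
  have hc : ((𝓜 i).verts \ {v}).ncard = 2 * γ - 1 := by
    rw [Set.ncard_sdiff_singleton_of_mem hv, h.ncard_verts]
  have himg : (lab i v '' ((𝓜 i).verts \ {v})).ncard = 2 * γ - 1 := by
    rw [(hlab i v hv).ncard_image, hc]
  have huniv : lab i v '' ((𝓜 i).verts \ {v}) = Set.univ := by
    apply Set.eq_of_subset_of_ncard_le (Set.subset_univ _)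
    rw [himg, Set.ncard_univ]
    simp
  obtain ⟨x, ⟨hx, hxv⟩, hxj⟩ := huniv.symm ▸ Set.mem_univ j
  exact ⟨x, hx, hxv, hxj⟩

/-! ### Decodability, rate and memory of the scheme -/

section RSCode

variable {n m γ τ : ℕ} {G : SimpleGraph (Fin n)} {𝓜 : Fin τ → G.Subgraph}
  {lab : Fin τ → Fin n → Fin n → Fin (2 * γ - 1)}

theorem rsCode_place_eq {B : ℕ} {W W' : Fin m → (rsCode 𝓜 γ lab m B).fileBit → ZMod 2} {u : Fin n}
    (h : (rsCode 𝓜 γ lab m B).place u W = (rsCode 𝓜 γ lab m B).place u W')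
    (f : Fin m) {w : Fin n} (hw : ¬ G.Adj u w) (j : Fin (2 * γ - 1)) (b : Fin B) :
    W f ((w, j), b) = W' f ((w, j), b) :=
  congrFun h ⟨(f, ((w, j), b)), hw⟩

/-- The cache of `u` and the messages of all other users determine the file requested by `u`. -/
theorem rsCode_determines (h : IsRSDecomposition G γ 𝓜) (hlab : IsPacketAssignment 𝓜 lab) {B : ℕ}
    {W W' : Fin m → (rsCode 𝓜 γ lab m B).fileBit → ZMod 2} {d : Fin n → Fin m} {u : Fin n}
    (hplace : (rsCode 𝓜 γ lab m B).place u W = (rsCode 𝓜 γ lab m B).place u W')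
    (hmsg : ∀ v, (rsCode 𝓜 γ lab m B).message W d v = (rsCode 𝓜 γ lab m B).message W' d v) :
    W (d u) = W' (d u) := by
  classical
  funext ⟨⟨w, j⟩, b⟩
  by_cases huw : G.Adj u w
  swap
  · exact rsCode_place_eq hplace _ huw j b
  obtain ⟨i, hi⟩ : ∃ i, s(u, w) ∈ (𝓜 i).edgeSet := by
    have : s(u, w) ∈ ⋃ i, (𝓜 i).edgeSet := by rw [h.cover]; exact huw
    simpa using this
  have hadj : (𝓜 i).Adj u w := hi
  obtain ⟨x, hx, hxu, hxj⟩ := hlab.exists_eq h hadj.fst_mem j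
  have hm := congrFun (hmsg x) (⟨i, hx⟩, b)
  -- If x were adjacent to w, inducedness would put xw in the matching, so x would be the partner u
  -- of w. This also covers x = w.
  have hxw : ¬ G.Adj x w := fun hxw =>
    hxu ((h.isMatching i).eq_of_adj_right (h.isInduced i hx hadj.snd_mem hxw) hadj)
  simp only [D2DCode.message, rsCode] at hm
  -- In the difference of the two messages of x only the term of u and its partner w survives: in
  -- every other term the packet is cached by u, hence is the same in both libraries.
  rw [← sub_eq_zero, ← Finset.sum_sub_distrib, Finset.sum_eq_single u, ← Finset.sum_sub_distrib,
    Finset.sum_eq_single w] at hm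
  · rw [if_pos ⟨hxu.symm, hadj⟩, if_pos ⟨hxu.symm, hadj⟩, dif_pos hxw, dif_pos hxw] at hm
    have := sub_eq_zero.1 hm
    rwa [hxj] at this
  · intro w' _ hw'
    rw [if_neg, if_neg, sub_zero] <;>
    exact fun hc => hw' ((h.isMatching i).eq_of_adj_left hc.2 hadj)
  · simp
  · intro v _ hvu
    rw [← Finset.sum_sub_distrib]
    refine Finset.sum_eq_zero fun w' _ => ?_
    by_cases hc : v ≠ x ∧ (𝓜 i).Adj v w'
    swap
    · rw [if_neg hc, if_neg hc, sub_zero]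
    rw [if_pos hc, if_pos hc]
    by_cases hxw' : G.Adj x w'
    · rw [dif_neg (by simpa using hxw'), dif_neg (by simpa using hxw'), sub_zero]
    rw [dif_pos hxw', dif_pos hxw', sub_eq_zero]
    refine rsCode_place_eq hplace _ (fun huw' => hvu ?_) _ _
    exact (h.isMatching i).eq_of_adj_right hc.2 (h.isInduced i hadj.fst_mem hc.2.snd_mem huw')
  · simp

theorem rsCode_fileSize (B : ℕ) : (rsCode 𝓜 γ lab m B).fileSize = n * (2 * γ - 1) * B := by
  simp [D2DCode.fileSize, rsCode]

theorem rsCode_sum_msgSize (h : IsRSDecomposition G γ 𝓜) (B : ℕ) :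
    ∑ u, (rsCode 𝓜 γ lab m B).msgSize u = τ * (2 * γ) * B := by
  classical
  have hsize : ∀ u, (rsCode 𝓜 γ lab m B).msgSize u =
      (∑ i, if u ∈ (𝓜 i).verts then 1 else 0) * B := by
    intro u
    simp only [D2DCode.msgSize, rsCode, Nat.card_prod, Nat.card_fin]
    rw [Nat.card_eq_fintype_card, Fintype.card_subtype, Finset.card_filter]
  simp_rw [hsize]
  rw [← Finset.sum_mul, Finset.sum_comm]
  congr 1
  rw [Finset.sum_const_nat (m := 2 * γ)]
  · simp
  intro i _
  rw [← h.ncard_verts i, ← Finset.card_filter, Set.ncard_eq_toFinset_card']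
  congr 1
  ext; simp

theorem rsCode_fitsMemory (hm : 0 < m) {M : ℝ}
    (hM : ∀ u, (n : ℝ) - (G.neighborSet u).ncard ≤ n * M / m) (B : ℕ) :
    (rsCode 𝓜 γ lab m B).FitsMemory M := by
  classical
  intro u
  have hcard : Nat.card ((rsCode 𝓜 γ lab m B).cacheBit u) =
      m * ((n - (G.neighborSet u).ncard) * (2 * γ - 1) * B) := by
    let e : (rsCode 𝓜 γ lab m B).cacheBit u ≃
        Fin m × (({w // ¬ G.Adj u w} × Fin (2 * γ - 1)) × Fin B) :=
      { toFun q := (q.1.1, ((⟨q.1.2.1.1, q.2⟩, q.1.2.1.2), q.1.2.2))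
        invFun q := ⟨(q.1, ((q.2.1.1.1, q.2.1.2), q.2.2)), q.2.1.1.2⟩
        left_inv _ := rfl
        right_inv _ := rfl }
    rw [Nat.card_congr e]
    simp only [Nat.card_prod, Nat.card_fin]
    congr 3
    have : {w | ¬ G.Adj u w} = (G.neighborSet u)ᶜ := rfl
    change ({w | ¬ G.Adj u w} : Set (Fin n)).ncard = _
    rw [this, Set.ncard_compl]
    simp
  have hle : (G.neighborSet u).ncard ≤ n := by
    simpa using Set.ncard_le_ncard (Set.subset_univ (G.neighborSet u))
  rw [hcard, rsCode_fileSize]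
  have hmpos : (0 : ℝ) < m := by exact_mod_cast hm
  have h1 : (m : ℝ) * ((n : ℝ) - (G.neighborSet u).ncard) ≤ n * M := by
    have := hM u
    rwa [le_div_iff₀ hmpos, mul_comm] at this
  push_cast [Nat.cast_sub hle]
  calc (m : ℝ) * ((n - (G.neighborSet u).ncard) * ((2 * γ - 1 : ℕ) : ℝ) * B)
      = m * (n - (G.neighborSet u).ncard) * (((2 * γ - 1 : ℕ) : ℝ) * B) := by ring
    _ ≤ n * M * (((2 * γ - 1 : ℕ) : ℝ) * B) := by gcongr
    _ = M * (n * ((2 * γ - 1 : ℕ) : ℝ) * B) := by ring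

end RSCode

/-! ### Time-sharing delivery and achievability -/

/-- A schedule in which the users transmit one after the other, user `u` for `t u` channel uses,
and everybody listens. -/
theorem exists_roundRobin {n : ℕ} (t : Fin n → ℕ) :
    ∃ π : TransmissionPolicy n, π.channelUses = ∑ u, t u ∧
      (∀ s, ∃ v, π.active s ⊆ {l | l.1 = v}) ∧
      ∀ u v, {s | (v, u) ∈ π.active s}.ncard = t v := by
  refine ⟨⟨∑ u, t u, fun s => {l | l.1 = (finSigmaFinEquiv.symm s).1}⟩, rfl,
    fun s => ⟨_, subset_rfl⟩, fun u v => ?_⟩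
  have : {s : Fin (∑ u, t u) | (v, u) ∈ {l : Fin n × Fin n | l.1 = (finSigmaFinEquiv.symm s).1}} =
      Set.range fun k : Fin (t v) => finSigmaFinEquiv (⟨v, k⟩ : (i : Fin n) × Fin (t i)) := by
    ext s
    obtain ⟨⟨w, k⟩, rfl⟩ := finSigmaFinEquiv.surjective s
    simp only [Set.mem_ofPred_eq, Equiv.symm_apply_apply, Set.mem_range, EmbeddingLike.apply_eq_iff_eq]
    constructor
    · rintro rfl
      exact ⟨k, rfl⟩
    · rintro ⟨k', hk'⟩
      exact (Sigma.mk.inj_iff.1 hk').1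
  rw [this, ← Set.image_univ, Set.ncard_image_of_injective, Set.ncard_univ]
  · simp
  · intro k k' hk
    simpa using hk

theorem dist_le_sqrt_two {n : ℕ} {pos : Fin n → EuclideanSpace ℝ (Fin 2)} (h : InUnitSquare pos)
    (u v : Fin n) : dist (pos u) (pos v) ≤ √2 := by
  rw [EuclideanSpace.dist_eq]
  apply Real.sqrt_le_sqrt
  rw [Fin.sum_univ_two, Real.dist_eq, Real.dist_eq, sq_abs, sq_abs]
  have h0 := h u 0
  have h1 := h u 1
  have h2 := h v 0
  have h3 := h v 1
  nlinarith

/-- In a network of diameter at most the transmission range, every user can receive all messages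
in `∑ u, ⌈msgSize u / C_r⌉` channel uses; hence a code whose caches and messages determine the
requested files has an error-free delivery. -/
theorem exists_delivery {n m : ℕ} (P : ProtocolModel) (hP : √2 ≤ P.range)
    {pos : Fin n → EuclideanSpace ℝ (Fin 2)} (hpos : InUnitSquare pos) (c : D2DCode n m)
    (hc : ∀ (W W' : Fin m → c.fileBit → ZMod 2) (d : Fin n → Fin m) (u : Fin n),
      c.place u W = c.place u W' → (∀ v, c.message W d v = c.message W' d v) →
        W (d u) = W' (d u)) :
    ∃ E : Delivery P c, E.Feasible pos ∧ E.errorProb = 0 ∧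
      E.policy.channelUses = ∑ u, ⌈(c.msgSize u : ℝ) / P.linkRate P.range⌉₊ := by
  classical
  have hC := P.linkRate_pos _ P.range_pos
  obtain ⟨π, hD, hone, hcount⟩ :=
    exists_roundRobin fun u => ⌈(c.msgSize u : ℝ) / P.linkRate P.range⌉₊
  have hrec : ∀ u v, v ∈ π.received P c u := by
    intro u v
    change (c.msgSize v : ℝ) ≤ P.linkRate P.range * ({s | (v, u) ∈ π.active s}.ncard : ℝ)
    rw [hcount, mul_comm, ← div_le_iff₀ hC]
    exact Nat.le_ceil _
  let E : Delivery P c :=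
    { policy := π
      decode := fun u y z d =>
        -- Decode from any library consistent with the observations; all such libraries agree on the
        -- requested file. The default 0 is never reached on genuine messages.
        if h : ∃ W, c.place u W = z ∧ ∀ v : π.received P c u, c.message W d v = y v
        then h.choose (d u) else 0 }
  have hdec : ∀ W d u, E.decoded W d u = W (d u) := by
    intro W d u
    have hex : ∃ W', c.place u W' = c.place u W ∧
        ∀ v : π.received P c u, c.message W' d v = c.message W d v := ⟨W, rfl, fun _ => rfl⟩
    change (if h : ∃ W', c.place u W' = c.place u W ∧
        ∀ v : π.received P c u, c.message W' d v = c.message W d v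
        then h.choose (d u) else 0) = _
    rw [dif_pos hex]
    exact hc _ _ _ _ hex.choose_spec.1 fun v => hex.choose_spec.2 ⟨v, hrec u v⟩
  refine ⟨E, ?_, ?_, hD⟩
  · intro s l hl
    -- The guard condition is vacuous, as only one user transmits at a time.
    refine ⟨(dist_le_sqrt_two hpos _ _).trans hP, fun k hk hkl => ?_⟩
    obtain ⟨v, hv⟩ := hone s
    exact absurd ((hv hk).trans (hv hl).symm) hkl
  · simp [Delivery.errorProb, hdec]

theorem rsRate_pos {n γ τ : ℕ} (hn : 0 < n) (hγ : 0 < γ) (hτ : 0 < τ) : 0 < rsRate n γ τ := by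
  have h1 : (1 : ℝ) ≤ γ := by exact_mod_cast hγ
  have h2 : (0 : ℝ) < n := by exact_mod_cast hn
  have h3 : (0 : ℝ) < τ := by exact_mod_cast hτ
  have h4 : (0 : ℝ) < 2 * γ - 1 := by linarith
  unfold rsRate
  positivity

/-- The Ruzsa-Szemerédi graph scheme achieves the rate `rsRate n γ τ` and the throughput
`C_r / rsRate n γ τ` when the range covers the unit square. -/
theorem achievedBy_rsCode {n m γ τ : ℕ} (hm : 0 < m) (hγ : 0 < γ) (hτ : 0 < τ)
    {G : SimpleGraph (Fin n)} {𝓜 : Fin τ → G.Subgraph} (h : IsRSDecomposition G γ 𝓜)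
    {lab : Fin τ → Fin n → Fin n → Fin (2 * γ - 1)} (hlab : IsPacketAssignment 𝓜 lab)
    {M : ℝ} (hM : ∀ u, (n : ℝ) - (G.neighborSet u).ncard ≤ n * M / m)
    {P : ProtocolModel} (hP : √2 ≤ P.range)
    {pos : Fin n → EuclideanSpace ℝ (Fin 2)} (hpos : InUnitSquare pos) :
    AchievedBy P pos (Set.range (rsCode 𝓜 γ lab m)) M
      (rsRate n γ τ) (P.linkRate P.range / rsRate n γ τ) := by
  intro ε hε
  have hn : 0 < n := by
    obtain ⟨v, hv⟩ := (Set.ncard_pos (s := (𝓜 ⟨0, hτ⟩).verts)).1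
      (by rw [h.ncard_verts]; omega)
    exact v.pos
  have hR := rsRate_pos hn hγ hτ
  have hC := P.linkRate_pos _ P.range_pos
  set C := P.linkRate P.range
  set R := rsRate n γ τ with hRdef
  choose E hE hE0 hED using fun k : ℕ =>
    exists_delivery P hP hpos (rsCode 𝓜 γ lab m (k + 1)) fun W W' d u => rsCode_determines h hlab
  have hF : Tendsto (fun k => (rsCode 𝓜 γ lab m (k + 1)).fileSize) atTop atTop := by
    refine tendsto_atTop_mono (fun k => ?_) tendsto_id
    rw [rsCode_fileSize]
    have : 0 < n * (2 * γ - 1) := Nat.mul_pos hn (by omega)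
    calc k ≤ 1 * (k + 1) := by omega
      _ ≤ _ := Nat.mul_le_mul_right _ this
  have hsum : ∀ k : ℕ, (∑ u, ((rsCode 𝓜 γ lab m (k + 1)).msgSize u : ℝ)) =
      R * (rsCode 𝓜 γ lab m (k + 1)).fileSize := by
    intro k
    have hγ' : (1 : ℝ) ≤ γ := by exact_mod_cast hγ
    have hn' : (n : ℝ) ≠ 0 := by exact_mod_cast hn.ne'
    have h4 : (2 * γ - 1 : ℝ) ≠ 0 := by linarith
    rw [← Nat.cast_sum, rsCode_sum_msgSize h, rsCode_fileSize, hRdef, rsRate]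
    push_cast [Nat.cast_sub (show 1 ≤ 2 * γ by omega)]
    field_simp
  refine ⟨fun k => rsCode 𝓜 γ lab m (k + 1), E, fun k => ⟨_, rfl⟩, hF,
    fun k => rsCode_fitsMemory hm hM _, hE, ?_, ?_, ?_⟩
  · intro η hη
    filter_upwards [hF.eventually_gt_atTop 0] with k hk
    have hk' : (0 : ℝ) < (rsCode 𝓜 γ lab m (k + 1)).fileSize := by exact_mod_cast hk
    rw [D2DCode.rate, hsum, mul_div_assoc, div_self hk'.ne']
    linarith
  · intro η hη
    filter_upwards with k
    rw [hE0]
    positivity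
  · intro η hη
    have hF' := (tendsto_natCast_atTop_atTop (R := ℝ)).comp hF
    filter_upwards [hF'.eventually_ge_atTop (n * (C / R) / η)] with k hk
    have hk' : n * (C / R) ≤ η * (rsCode 𝓜 γ lab m (k + 1)).fileSize := by
      rw [div_le_iff₀ hη] at hk
      simpa [mul_comm] using hk
    -- Each ceiling costs at most one channel use, n in total, independently of the file size.
    have hDle : ((E k).policy.channelUses : ℝ) ≤
        R * (rsCode 𝓜 γ lab m (k + 1)).fileSize / C + n := by
      rw [hED, ← hsum, Finset.sum_div, Nat.cast_sum]
      calc _ ≤ ∑ u : Fin n, (((rsCode 𝓜 γ lab m (k + 1)).msgSize u : ℝ) / C + 1) :=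
            Finset.sum_le_sum fun u _ => (Nat.ceil_lt_add_one (by positivity)).le
        _ = _ := by simp [Finset.sum_add_distrib]
    calc ((E k).policy.channelUses : ℝ) * (C / R)
        ≤ (R * (rsCode 𝓜 γ lab m (k + 1)).fileSize / C + n) * (C / R) := by gcongr
      _ = (rsCode 𝓜 γ lab m (k + 1)).fileSize + n * (C / R) := by field_simp
      _ ≤ _ := by linarith

/-! ### Cayley graphs decomposed by translated matchings -/

section Cayley

variable {V A : Type*} [AddCommGroup A]

/-- The Cayley graph of the differences in `S` and their negatives, transported along `φ`. -/
def cayleyGraph (φ : V ≃ A) (S : Set A) (hS : ∀ d ∈ S, ∀ d' ∈ S, d ≠ -d') : SimpleGraph V where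
  Adj x y := φ y - φ x ∈ S ∨ φ x - φ y ∈ S
  symm := ⟨fun _ _ h => h.symm⟩
  loopless := ⟨fun x h => by
    have h0 : (0 : A) ∈ S := by simpa using h
    exact hS 0 h0 0 h0 (by simp)⟩

theorem ncard_neighborSet_cayleyGraph [Finite A] (φ : V ≃ A) (S : Set A)
    (hS : ∀ d ∈ S, ∀ d' ∈ S, d ≠ -d') (x : V) :
    ((cayleyGraph φ S hS).neighborSet x).ncard = 2 * S.ncard := by
  have h1 : (cayleyGraph φ S hS).neighborSet x =
      (fun d => φ.symm (φ x + d)) '' S ∪ (fun d => φ.symm (φ x - d)) '' S := by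
    ext y
    change (φ y - φ x ∈ S ∨ φ x - φ y ∈ S) ↔ _
    refine or_congr ⟨fun h => ⟨_, h, by simp⟩, ?_⟩ ⟨fun h => ⟨_, h, by simp⟩, ?_⟩
    · rintro ⟨d, hd, rfl⟩
      simpa using hd
    · rintro ⟨d, hd, rfl⟩
      simpa using hd
  have hdisj : Disjoint ((fun d => φ.symm (φ x + d)) '' S) ((fun d => φ.symm (φ x - d)) '' S) := by
    rw [Set.disjoint_left]
    rintro _ ⟨d, hd, rfl⟩ ⟨d', hd', h⟩
    refine hS d hd d' hd' ?_
    have : φ x - d' = φ x + d := φ.symm.injective h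
    rw [sub_eq_add_neg] at this
    exact (add_left_cancel this).symm
  rw [h1, Set.ncard_union_eq hdisj (Set.toFinite _) (Set.toFinite _),
    Set.ncard_image_of_injective, Set.ncard_image_of_injective, two_mul]
  · intro d d' h
    simpa using h
  · intro d d' h
    simpa using h

/-- A Cayley graph of an abelian group of order `N` is a Ruzsa-Szemerédi graph if its differences up
to sign can be realised by edges `{a d, b d}` which form `q` induced matchings of equal size: the
translates of these matchings decompose the graph. -/
theorem isRSDecomposition_cayleyGraph {N q γ : ℕ} (φ : Fin N ≃ A) (C : Fin q → Finset A)
    (a b : A → A) (hab : ∀ d, b d - a d = d) (hcard : ∀ j, (C j).card = γ)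
    (hdisj : ∀ i j, i ≠ j → Disjoint (C i) (C j))
    (hS : ∀ d ∈ ⋃ j, (C j : Set A), ∀ d' ∈ ⋃ j, (C j : Set A), d ≠ -d')
    (hind : ∀ j, ∀ d ∈ C j, ∀ d' ∈ C j, d ≠ d' →
      ∀ p, (p = a d ∨ p = b d) → ∀ p', (p' = a d' ∨ p' = b d') →
        p ≠ p' ∧ p' - p ∉ ⋃ j, (C j : Set A)) :
    ∃ 𝓜 : Fin (N * q) → (cayleyGraph φ (⋃ j, (C j : Set A)) hS).Subgraph,
      IsRSDecomposition (cayleyGraph φ (⋃ j, (C j : Set A)) hS) γ 𝓜 := by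
  set S := ⋃ j, (C j : Set A) with hSdef
  have hmemS : ∀ {j d}, d ∈ C j → d ∈ S := fun {j d} hd => Set.mem_iUnion.2 ⟨j, hd⟩
  set H := cayleyGraph φ S hS with hH
  let tr : Fin (N * q) → A := fun i => φ (finProdFinEquiv.symm i).1
  let ix : Fin (N * q) → Fin q := fun i => (finProdFinEquiv.symm i).2
  have htrix : ∀ i i', tr i = tr i' → ix i = ix i' → i = i' := fun i i' h h' =>
    finProdFinEquiv.symm.injective (Prod.ext (φ.injective h) h')
  let verts : Fin (N * q) → Set (Fin N) := fun i =>
    {y | ∃ d ∈ C (ix i), φ y = tr i + a d ∨ φ y = tr i + b d}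
  -- Taking induced subgraphs makes inducedness automatic; the content is that they contain no edges
  -- beyond the intended ones.
  let 𝓜 : Fin (N * q) → H.Subgraph := fun i => (⊤ : H.Subgraph).induce (verts i)
  have hadj : ∀ i x y, (𝓜 i).Adj x y ↔ ∃ d ∈ C (ix i),
      (φ x = tr i + a d ∧ φ y = tr i + b d) ∨ (φ y = tr i + a d ∧ φ x = tr i + b d) := by
    intro i x y
    constructor
    · rintro ⟨⟨d, hd, hx⟩, ⟨d', hd', hy⟩, hxy⟩
      have hxy : φ y - φ x ∈ S ∨ φ x - φ y ∈ S := hxy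
      have hne : x ≠ y := by
        rintro rfl
        have h0 : (0 : A) ∈ S := by simpa using hxy
        exact hS 0 h0 0 h0 (by simp)
      by_cases hdd : d = d'
      · subst hdd
        refine ⟨d, hd, ?_⟩
        rcases hx with hx | hx <;> rcases hy with hy | hy
        · exact absurd (φ.injective (hx.trans hy.symm)) hne
        · exact .inl ⟨hx, hy⟩
        · exact .inr ⟨hy, hx⟩
        · exact absurd (φ.injective (hx.trans hy.symm)) hne
      · exfalso
        have hp : φ x - tr i = a d ∨ φ x - tr i = b d := by
          rcases hx with hx | hx <;> simp [hx]
        have hp' : φ y - tr i = a d' ∨ φ y - tr i = b d' := by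
          rcases hy with hy | hy <;> simp [hy]
        have h1 := (hind _ d hd d' hd' hdd _ hp _ hp').2
        have h2 := (hind _ d' hd' d hd (Ne.symm hdd) _ hp' _ hp).2
        rw [sub_sub_sub_cancel_right] at h1 h2
        exact hxy.elim h1 h2
    · rintro ⟨d, hd, ⟨hx, hy⟩ | ⟨hy, hx⟩⟩
      · refine ⟨⟨d, hd, .inl hx⟩, ⟨d, hd, .inr hy⟩, .inl ?_⟩
        rw [hx, hy, add_sub_add_left_eq_sub, hab]
        exact hmemS hd
      · refine ⟨⟨d, hd, .inr hx⟩, ⟨d, hd, .inl hy⟩, .inr ?_⟩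
        rw [hx, hy, add_sub_add_left_eq_sub, hab]
        exact hmemS hd
  have hne : ∀ {d}, d ∈ S → a d ≠ b d := by
    intro d hd h
    have h0 : d = 0 := by rw [← hab d, h, sub_self]
    exact hS d hd d hd (by simp [h0])
  have hedge : ∀ i, (𝓜 i).edgeSet =
      (fun d => s(φ.symm (tr i + a d), φ.symm (tr i + b d))) '' (C (ix i) : Set A) := by
    intro i
    ext e
    induction e with | _ x y =>
    rw [SimpleGraph.Subgraph.mem_edgeSet, hadj]
    constructor
    · rintro ⟨d, hd, ⟨hx, hy⟩ | ⟨hy, hx⟩⟩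
      · exact ⟨d, hd, by simp [← hx, ← hy]⟩
      · exact ⟨d, hd, by simp [← hx, ← hy, Sym2.eq_swap]⟩
    · rintro ⟨d, hd, h⟩
      refine ⟨d, hd, ?_⟩
      rcases Sym2.eq_iff.1 h with ⟨rfl, rfl⟩ | ⟨rfl, rfl⟩ <;> simp
  -- An edge determines its difference up to sign. As S contains no two opposite elements, the edge
  -- determines d, and then the translation.
  have hinj : ∀ i i' d d', d ∈ S → d' ∈ S →
      s(φ.symm (tr i + a d), φ.symm (tr i + b d)) =
        s(φ.symm (tr i' + a d'), φ.symm (tr i' + b d')) → d = d' ∧ tr i = tr i' := by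
    intro i i' d d' hd hd' h
    rcases Sym2.eq_iff.1 h with ⟨h1, h2⟩ | ⟨h1, h2⟩
    · have h1 := φ.symm.injective h1
      have h2 := φ.symm.injective h2
      have hdd : d = d' := by
        rw [← hab d, ← hab d', ← add_sub_add_left_eq_sub (b d) (a d) (tr i), h1, h2,
          add_sub_add_left_eq_sub]
      subst hdd
      exact ⟨rfl, add_right_cancel h1⟩
    · have h1 := φ.symm.injective h1
      have h2 := φ.symm.injective h2
      refine absurd ?_ (hS d hd d' hd')
      rw [← hab d, ← hab d', ← add_sub_add_left_eq_sub (b d) (a d) (tr i), h1, h2,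
        add_sub_add_left_eq_sub, neg_sub]
  refine ⟨𝓜, ?_, ?_, ?_, ?_, ?_⟩
  · intro i x hx
    obtain ⟨d, hd, hxd⟩ := hx
    have hone : ∀ d' ∈ C (ix i), (φ x = tr i + a d' ∨ φ x = tr i + b d') → d' = d := by
      intro d' hd' hxd'
      by_contra hdd
      have hp : φ x - tr i = a d ∨ φ x - tr i = b d := by
        rcases hxd with hx | hx <;> simp [hx]
      have hp' : φ x - tr i = a d' ∨ φ x - tr i = b d' := by
        rcases hxd' with hx | hx <;> simp [hx]
      exact (hind _ d' hd' d hd hdd _ hp' _ hp).1 rfl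
    have hned := hne (hmemS hd)
    rcases hxd with hxd | hxd
    · refine ⟨φ.symm (tr i + b d), (hadj _ _ _).2 ⟨d, hd, .inl ⟨hxd, by simp⟩⟩, fun y hy => ?_⟩
      obtain ⟨d', hd', h⟩ := (hadj _ _ _).1 hy
      obtain rfl : d' = d := hone d' hd' (h.imp And.left And.right)
      rcases h with h | h
      · rw [← h.2, Equiv.symm_apply_apply]
      · exact absurd (add_left_cancel (hxd.symm.trans h.2)) hned
    · refine ⟨φ.symm (tr i + a d), (hadj _ _ _).2 ⟨d, hd, .inr ⟨by simp, hxd⟩⟩, fun y hy => ?_⟩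
      obtain ⟨d', hd', h⟩ := (hadj _ _ _).1 hy
      obtain rfl : d' = d := hone d' hd' (h.imp And.left And.right)
      rcases h with h | h
      · exact absurd (add_left_cancel (h.1.symm.trans hxd)) hned
      · rw [← h.1, Equiv.symm_apply_apply]
  · intro i x hx y hy hxy
    exact ⟨hx, hy, hxy⟩
  · intro i
    rw [hedge, Set.InjOn.ncard_image, Set.ncard_coe_finset, hcard]
    intro d hd d' hd' h
    exact (hinj i i d d' (hmemS hd) (hmemS hd') h).1
  · intro i i' hii
    rw [hedge, hedge, Set.disjoint_left]
    rintro _ ⟨d, hd, rfl⟩ ⟨d', hd', h⟩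
    obtain ⟨rfl, htr⟩ := hinj i i' d d' (hmemS hd) (hmemS hd') h.symm
    have hix : ix i = ix i' := by
      by_contra hc
      exact Finset.disjoint_left.1 (hdisj _ _ hc) hd hd'
    exact hii (htrix i i' htr hix)
  · ext e
    induction e with | _ x y =>
    constructor
    · intro h
      obtain ⟨i, hi⟩ := Set.mem_iUnion.1 h
      exact (𝓜 i).edgeSet_subset hi
    · intro h
      -- With d = φ y - φ x, the edge xy is the translate of {a d, b d} by φ x - a d.
      have key : ∀ x y, φ y - φ x ∈ S → ∃ i, (𝓜 i).Adj x y := by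
        intro x y h
        obtain ⟨j, hj⟩ := Set.mem_iUnion.1 h
        obtain ⟨i, htr, hix⟩ : ∃ i, tr i = φ x - a (φ y - φ x) ∧ ix i = j :=
          ⟨finProdFinEquiv (φ.symm (φ x - a (φ y - φ x)), j),
            by simp only [tr, Equiv.symm_apply_apply, Equiv.apply_symm_apply],
            by simp only [ix, Equiv.symm_apply_apply]⟩
        refine ⟨i, (hadj _ _ _).2 ⟨φ y - φ x, hix ▸ hj, .inl ⟨by rw [htr]; abel, ?_⟩⟩⟩
        rw [htr, sub_add_eq_add_sub, add_sub_assoc, hab]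
        abel
      refine Set.mem_iUnion.2 ?_
      have h : φ y - φ x ∈ S ∨ φ x - φ y ∈ S := h
      rcases h with h | h
      · exact key x y h
      · obtain ⟨i, hi⟩ := key y x h
        exact ⟨i, hi.symm⟩

end Cayley

/-! ### Greedy disjoint independent sets -/

section Greedy

variable {α : Type*} [DecidableEq α] {conf : α → α → Prop} {Δ : ℕ}

/-- In a graph in which every vertex of `X` has at most `Δ` neighbours in `X`, the set `X` contains
an independent set of size `γ` whenever `|X| ≥ (Δ + 1) γ`. -/
theorem exists_independent_of_degree_le [DecidableRel conf] (hsymm : ∀ d d', conf d d' → conf d' d)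
    (γ : ℕ) (X : Finset α) (hdeg : ∀ d ∈ X, (X.filter (conf d)).card ≤ Δ)
    (hX : (Δ + 1) * γ ≤ X.card) :
    ∃ Y ⊆ X, Y.card = γ ∧ ∀ d ∈ Y, ∀ d' ∈ Y, d ≠ d' → ¬ conf d d' := by
  induction γ generalizing X with
  | zero => exact ⟨∅, by simp⟩
  | succ γ ih =>
    obtain ⟨x, hx⟩ : X.Nonempty := by
      rw [← Finset.card_pos]
      exact lt_of_lt_of_le (by positivity) hX
    obtain ⟨Y, hYX, hY, hind⟩ := ih (X \ insert x (X.filter (conf x)))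
      (fun d hd => (Finset.card_le_card (Finset.filter_subset_filter _ Finset.sdiff_subset)).trans
        (hdeg d (Finset.mem_sdiff.1 hd).1)) (by
        have h1 := Finset.le_card_sdiff (insert x (X.filter (conf x))) X
        have h2 := Finset.card_insert_le x (X.filter (conf x))
        have h3 := hdeg x hx
        rw [mul_add] at hX
        omega)
    have hxY : ∀ y ∈ Y, y ≠ x ∧ ¬ conf x y := by
      intro y hy
      have := hYX hy
      simp only [Finset.mem_sdiff, Finset.mem_insert, Finset.mem_filter, not_or, not_and] at this
      exact ⟨this.2.1, this.2.2 this.1⟩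
    refine ⟨insert x Y, ?_, ?_, ?_⟩
    · exact Finset.insert_subset hx (hYX.trans Finset.sdiff_subset)
    · rw [Finset.card_insert_of_notMem fun h => (hxY x h).1 rfl, hY]
    · intro d hd d' hd' hdd
      rcases Finset.mem_insert.1 hd with rfl | hdY <;>
        rcases Finset.mem_insert.1 hd' with rfl | hdY'
      · exact absurd rfl hdd
      · exact (hxY d' hdY').2
      · exact fun hc => (hxY d hdY).2 (hsymm _ _ hc)
      · exact hind d hdY d' hdY' hdd

/-- In a graph of maximum degree `Δ` on `X` there are `q` disjoint independent sets of size `γ`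
whenever `|X| ≥ (q + Δ + 1) γ`. -/
theorem exists_disjoint_independent [DecidableRel conf] (hsymm : ∀ d d', conf d d' → conf d' d)
    (γ q : ℕ) (X : Finset α) (hdeg : ∀ d ∈ X, (X.filter (conf d)).card ≤ Δ)
    (hX : (q + (Δ + 1)) * γ ≤ X.card) :
    ∃ C : Fin q → Finset α, (∀ j, C j ⊆ X) ∧ (∀ j, (C j).card = γ) ∧
      (∀ i j, i ≠ j → Disjoint (C i) (C j)) ∧
      ∀ j, ∀ d ∈ C j, ∀ d' ∈ C j, d ≠ d' → ¬ conf d d' := by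
  induction q generalizing X with
  | zero => exact ⟨Fin.elim0, fun j => j.elim0, fun j => j.elim0, fun j => j.elim0, fun j => j.elim0⟩
  | succ q ih =>
    obtain ⟨Y, hYX, hY, hind⟩ := exists_independent_of_degree_le hsymm γ X hdeg
      (le_trans (Nat.mul_le_mul_right _ (by omega)) hX)
    obtain ⟨C, hC, hCc, hCd, hCi⟩ := ih (X \ Y)
      (fun d hd => (Finset.card_le_card (Finset.filter_subset_filter _ Finset.sdiff_subset)).trans
        (hdeg d (Finset.mem_sdiff.1 hd).1)) (by
        rw [Finset.card_sdiff_of_subset hYX, hY]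
        have : (q + 1 + (Δ + 1)) * γ = (q + (Δ + 1)) * γ + γ := by ring
        omega)
    have hYC : ∀ j, Disjoint Y (C j) := fun j =>
      Finset.disjoint_left.2 fun y hy hyC => (Finset.mem_sdiff.1 (hC j hyC)).2 hy
    refine ⟨Fin.cons Y C, ?_, ?_, ?_, ?_⟩
    · exact Fin.cases hYX fun j => (hC j).trans Finset.sdiff_subset
    · exact Fin.cases hY hCc
    · refine Fin.cases (Fin.cases (fun h => absurd rfl h) fun j _ => hYC j) fun i =>
        Fin.cases (fun _ => (hYC i).symm) fun j hij => hCd i j fun h => hij (by rw [h])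
    · exact Fin.cases hind hCi

end Greedy

/-! ### Counting lattice points in a ball -/

section LatticePoints

theorem sum_Icc_half_pow_natAbs (K : ℕ) :
    ∑ k ∈ Finset.Icc (-(K : ℤ)) K, (1 / 2 : ℝ) ^ k.natAbs = 3 - 2 * (1 / 2) ^ K := by
  induction K with
  | zero => norm_num
  | succ K ih =>
    have h : Finset.Icc (-((K + 1 : ℕ) : ℤ)) ((K + 1 : ℕ) : ℤ) =
        insert ((K + 1 : ℕ) : ℤ) (insert (-((K + 1 : ℕ) : ℤ)) (Finset.Icc (-(K : ℤ)) K)) := by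
      ext k
      simp only [Finset.mem_Icc, Finset.mem_insert]
      omega
    rw [h, Finset.sum_insert, Finset.sum_insert, ih, Int.natAbs_neg, Int.natAbs_natCast]
    · ring
    · simp
    · simp only [Finset.mem_insert, Finset.mem_Icc]
      omega

/-- The integer points in the ball of radius `√(3 z)` in dimension `z`. -/
noncomputable def latticeBall (z : ℕ) : Finset (Fin z → ℤ) :=
  (Fintype.piFinset fun _ => Finset.Icc (-((3 * z : ℕ) : ℤ)) ((3 * z : ℕ) : ℤ)).filter
    fun s => ∑ i, s i ^ 2 ≤ 3 * z

theorem mem_latticeBall {z : ℕ} {s : Fin z → ℤ} : s ∈ latticeBall z ↔ ∑ i, s i ^ 2 ≤ 3 * z := by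
  refine ⟨fun h => (Finset.mem_filter.1 h).2, fun h => Finset.mem_filter.2 ⟨?_, h⟩⟩
  rw [Fintype.mem_piFinset]
  intro i
  have h1 : s i ^ 2 ≤ 3 * z :=
    (Finset.single_le_sum (f := fun i => s i ^ 2) (fun _ _ => sq_nonneg _) (Finset.mem_univ i)).trans
      h
  have h2 := Int.natAbs_le_self_sq (s i)
  rw [Finset.mem_Icc]
  push_cast
  omega

/-- Give s the weight 2^(-∑ sᵢ²), which is at least 8^(-z) on the ball. The total weight factors
over the coordinates, and each factor is at most ∑ 2^(-|k|) ≤ 3. -/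
theorem card_latticeBall_le (z : ℕ) : (latticeBall z).card ≤ 24 ^ z := by
  have hw : ∀ s ∈ latticeBall z, (1 : ℝ) ≤ 8 ^ z * ∏ i, (1 / 2 : ℝ) ^ ((s i).natAbs ^ 2) := by
    intro s hs
    have h1 : ∑ i, (s i).natAbs ^ 2 ≤ 3 * z := by
      have := mem_latticeBall.1 hs
      zify
      simpa using this
    rw [Finset.prod_pow_eq_pow_sum]
    calc (1 : ℝ) = 8 ^ z * (1 / 2) ^ (3 * z) := by
          rw [pow_mul, ← mul_pow]; norm_num
      _ ≤ _ := by
          gcongr 8 ^ z * ?_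
          exact pow_le_pow_of_le_one (by norm_num) (by norm_num) h1
  have : ((latticeBall z).card : ℝ) ≤ 24 ^ z := by
    calc ((latticeBall z).card : ℝ) = ∑ s ∈ latticeBall z, (1 : ℝ) := by simp
      _ ≤ ∑ s ∈ latticeBall z, 8 ^ z * ∏ i, (1 / 2 : ℝ) ^ ((s i).natAbs ^ 2) :=
          Finset.sum_le_sum hw
      _ ≤ ∑ s ∈ Fintype.piFinset fun _ : Fin z =>
            Finset.Icc (-((3 * z : ℕ) : ℤ)) ((3 * z : ℕ) : ℤ),
            8 ^ z * ∏ i, (1 / 2 : ℝ) ^ ((s i).natAbs ^ 2) :=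
          Finset.sum_le_sum_of_subset_of_nonneg (Finset.filter_subset _ _)
            fun _ _ _ => by positivity
      _ = 8 ^ z * (∑ k ∈ Finset.Icc (-((3 * z : ℕ) : ℤ)) ((3 * z : ℕ) : ℤ),
            (1 / 2 : ℝ) ^ (k.natAbs ^ 2)) ^ z := by
          have := Finset.prod_univ_sum
            (fun _ : Fin z => Finset.Icc (-((3 * z : ℕ) : ℤ)) ((3 * z : ℕ) : ℤ))
            fun _ k => (1 / 2 : ℝ) ^ (k.natAbs ^ 2)
          rw [← Finset.mul_sum, ← this, Finset.prod_const, Finset.card_fin]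
      _ ≤ 8 ^ z * 3 ^ z := by
          gcongr
          calc _ ≤ ∑ k ∈ Finset.Icc (-((3 * z : ℕ) : ℤ)) ((3 * z : ℕ) : ℤ),
                (1 / 2 : ℝ) ^ k.natAbs := Finset.sum_le_sum fun k _ =>
                  pow_le_pow_of_le_one (by norm_num) (by norm_num)
                    (Nat.le_self_pow (by norm_num) _)
            _ ≤ 3 := by
                rw [sum_Icc_half_pow_natAbs]
                have : (0 : ℝ) ≤ (1 / 2) ^ (3 * z) := by positivity
                linarith
      _ = 24 ^ z := by rw [← mul_pow]; norm_num
  exact_mod_cast this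

end LatticePoints

/-! ### Splitting an integer vector into balanced halves -/

section Halves

/-- Signs can be chosen so that a signed sum is no larger than the largest summand. -/
theorem exists_balanced_signs {z : ℕ} (x : Fin z → ℤ) {L : ℤ} (hL : 0 ≤ L) (hx : ∀ i, |x i| ≤ L) :
    ∃ s : Fin z → ℤ, (∀ i, s i = 1 ∨ s i = -1) ∧ |∑ i, s i * x i| ≤ L := by
  induction z with
  | zero => exact ⟨Fin.elim0, fun i => i.elim0, by simpa using hL⟩
  | succ z ih =>
    obtain ⟨s, hs, hsum⟩ := ih (fun i => x i.succ) fun i => hx _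
    have h0 := hx 0
    have : ∃ t : ℤ, (t = 1 ∨ t = -1) ∧ |t * x 0 + ∑ i, s i * x i.succ| ≤ L := by
      rw [abs_le] at hsum h0
      -- Give the new summand the sign opposite to the partial sum: two numbers of opposite signs
      -- bounded by L have a sum bounded by L.
      by_cases h : (0 ≤ x 0) = (0 ≤ ∑ i, s i * x i.succ)
      · refine ⟨-1, .inr rfl, abs_le.2 ?_⟩
        by_cases h' : 0 ≤ x 0
        · have := h ▸ h'
          constructor <;> linarith
        · have h'' : ¬ 0 ≤ ∑ i, s i * x i.succ := h ▸ h'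
          constructor <;> linarith
      · refine ⟨1, .inl rfl, abs_le.2 ?_⟩
        by_cases h' : 0 ≤ x 0
        · have h'' : ¬ 0 ≤ ∑ i, s i * x i.succ := fun h'' => h (by simp [h', h''])
          constructor <;> linarith
        · have h'' : 0 ≤ ∑ i, s i * x i.succ := by
            by_contra h''
            exact h (by simp only [h', h''])
          constructor <;> linarith
    obtain ⟨t, ht, htsum⟩ := this
    refine ⟨Fin.cons t s, Fin.cases ht hs, ?_⟩
    rw [Fin.sum_univ_succ]
    simpa using htsum

/-- An integer vector `D` is a difference `v - u` of two integer vectors which are nearly opposite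
and nearly of the same length. -/
theorem exists_balanced_halves {z : ℕ} (D : Fin z → ℤ) {L : ℤ} (hL : 0 ≤ L) (hD : ∀ i, |D i| ≤ L) :
    ∃ u v : Fin z → ℤ, (∀ i, v i - u i = D i) ∧ (∀ i, |u i + v i| ≤ 1) ∧
      4 * ∑ i, u i ^ 2 ≤ z + ∑ i, D i ^ 2 + 2 * L ∧
      4 * ∑ i, v i ^ 2 ≤ z + ∑ i, D i ^ 2 + 2 * L := by
  obtain ⟨s, hs, hsum⟩ := exists_balanced_signs (fun i => if Even (D i) then 0 else D i) hL fun i => by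
    split_ifs
    · simpa using hL
    · exact hD i
  -- The halves are u = (e - D)/2 and v = (e + D)/2, where e repairs the parity at odd coordinates.
  -- Their squared lengths differ only through the inner product e · D, which the balanced signs
  -- keep within L.
  let e : Fin z → ℤ := fun i => if Even (D i) then 0 else s i
  have he : ∑ i, e i * D i = ∑ i, s i * (if Even (D i) then 0 else D i) := by
    refine Finset.sum_congr rfl fun i _ => ?_
    simp only [e]
    split_ifs <;> simp
  rw [← he, abs_le] at hsum
  have he1 : ∀ i, |e i| ≤ 1 := by
    intro i
    simp only [e]
    split_ifs
    · simp
    · rcases hs i with h | h <;> simp [h]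
  have hesq : ∑ i, e i ^ 2 ≤ z := by
    calc ∑ i, e i ^ 2 ≤ ∑ _i : Fin z, (1 : ℤ) :=
          Finset.sum_le_sum fun i _ => (sq_le_one_iff_abs_le_one _).2 (he1 i)
      _ = z := by simp
  have hpar : ∀ i, ∃ u, 2 * u = e i - D i := by
    intro i
    have : Even (e i - D i) := by
      simp only [e]
      split_ifs with h
      · simpa using h
      · have h := Int.not_even_iff_odd.1 h
        rcases hs i with h1 | h1 <;> rw [h1]
        · exact Odd.sub_odd odd_one h
        · exact Odd.sub_odd (by decide) h
    obtain ⟨u, hu⟩ := this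
    exact ⟨u, by omega⟩
  choose u hu using hpar
  have hsq : ∀ σ : ℤ, σ ^ 2 = 1 →
      ∑ i, (e i + σ * D i) ^ 2 = ∑ i, e i ^ 2 + ∑ i, D i ^ 2 + 2 * σ * ∑ i, e i * D i := by
    intro σ hσ
    rw [Finset.mul_sum, ← Finset.sum_add_distrib, ← Finset.sum_add_distrib]
    refine Finset.sum_congr rfl fun i _ => ?_
    linear_combination (D i) ^ 2 * hσ
  refine ⟨u, fun i => u i + D i, fun i => by ring, fun i => ?_, ?_, ?_⟩
  · rw [show u i + (u i + D i) = e i by linarith [hu i]]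
    exact he1 i
  · have : 4 * ∑ i, u i ^ 2 = ∑ i, (e i + (-1) * D i) ^ 2 := by
      rw [Finset.mul_sum]
      refine Finset.sum_congr rfl fun i _ => ?_
      rw [show e i + (-1) * D i = 2 * u i by linarith [hu i]]
      ring
    rw [this, hsq (-1) (by norm_num)]
    linarith
  · have : 4 * ∑ i, (u i + D i) ^ 2 = ∑ i, (e i + 1 * D i) ^ 2 := by
      rw [Finset.mul_sum]
      refine Finset.sum_congr rfl fun i _ => ?_
      rw [show e i + 1 * D i = 2 * (u i + D i) by linarith [hu i]]
      ring
    rw [this, hsq 1 (by norm_num)]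
    linarith

end Halves

/-! ### The shell in the torus and its conflicts -/

section Torus

variable {Λ z : ℕ}

/-- The squared Euclidean length of the shortest integer representative of `d`. -/
def torusSq (d : Fin z → ZMod Λ) : ℤ := ∑ i, (d i).valMinAbs ^ 2

/-- Reduction of an integer vector modulo `Λ`. -/
def torusCast (Λ : ℕ) {z : ℕ} (s : Fin z → ℤ) : Fin z → ZMod Λ := fun i => (s i : ZMod Λ)

theorem torusSq_neg [NeZero Λ] (d : Fin z → ZMod Λ) : torusSq (-d) = torusSq d := by
  refine Finset.sum_congr rfl fun i _ => ?_
  rw [← Int.natAbs_sq, ← Int.natAbs_sq (d i).valMinAbs, Pi.neg_apply, ZMod.natAbs_valMinAbs_neg]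

theorem torusSq_torusCast_le [NeZero Λ] (s : Fin z → ℤ) : torusSq (torusCast Λ s) ≤ ∑ i, s i ^ 2 := by
  refine Finset.sum_le_sum fun i _ => ?_
  rw [← Int.natAbs_sq, ← Int.natAbs_sq (s i)]
  have := ZMod.natAbs_min_of_le_div_two Λ (torusCast Λ s i).valMinAbs (s i)
    (by simp [torusCast]) (ZMod.natAbs_valMinAbs_le _)
  gcongr

open Classical in
/-- The vectors in the torus whose squared length is within `z / 2` of `μ`. -/
noncomputable def torusShell (Λ z : ℕ) [NeZero Λ] (μ : ℝ) : Finset (Fin z → ZMod Λ) :=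
  Finset.univ.filter fun d => |(torusSq d : ℝ) - μ| ≤ z / 2

theorem mem_torusShell [NeZero Λ] {μ : ℝ} {d : Fin z → ZMod Λ} :
    d ∈ torusShell Λ z μ ↔ |(torusSq d : ℝ) - μ| ≤ z / 2 := by
  simp [torusShell]

theorem neg_mem_torusShell [NeZero Λ] {μ : ℝ} {d : Fin z → ZMod Λ} :
    -d ∈ torusShell Λ z μ ↔ d ∈ torusShell Λ z μ := by
  rw [mem_torusShell, mem_torusShell, torusSq_neg]

/-- The edges `{a d, b d}` and `{a d', b d'}` share an endpoint, or are joined by an edge whose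
difference is in `S`. -/
def EdgeConflict {A : Type*} [AddCommGroup A] (a b : A → A) (S : Finset A) (d d' : A) : Prop :=
  ∃ p, (p = a d ∨ p = b d) ∧ ∃ p', (p' = a d' ∨ p' = b d') ∧ (p = p' ∨ p' - p ∈ S)

theorem EdgeConflict.symm {A : Type*} [AddCommGroup A] {a b : A → A} {S : Finset A}
    (hS : ∀ d, -d ∈ S ↔ d ∈ S) {d d' : A} (h : EdgeConflict a b S d d') :
    EdgeConflict a b S d' d := by
  obtain ⟨p, hp, p', hp', h⟩ := h
  refine ⟨p', hp', p, hp, h.imp Eq.symm fun h => ?_⟩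
  rwa [← hS, neg_sub]

open Classical in
/-- Every difference in a shell of the torus can be realised by an edge close to the origin so that
few of these edges are in conflict with a given one. -/
theorem exists_edges_few_conflicts [NeZero Λ] (hz : Λ ≤ z) (μ : ℝ) :
    ∃ a b : (Fin z → ZMod Λ) → (Fin z → ZMod Λ), (∀ d, b d - a d = d) ∧
      ∀ d ∈ torusShell Λ z μ, ((torusShell Λ z μ).filter
        (EdgeConflict a b (torusShell Λ z μ) d)).card ≤ 8 * 72 ^ z := by
  have hhalf : ∀ d : Fin z → ZMod Λ, ∀ i, |(d i).valMinAbs| ≤ ((Λ / 2 : ℕ) : ℤ) := by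
    intro d i
    rw [Int.abs_eq_natAbs]
    exact_mod_cast ZMod.natAbs_valMinAbs_le (d i)
  choose u v hdiff hsum hu hv using fun d : Fin z → ZMod Λ =>
    exists_balanced_halves (fun i => (d i).valMinAbs) (Int.natCast_nonneg _) (hhalf d)
  have hab : ∀ d, torusCast Λ (v d) - torusCast Λ (u d) = d := by
    intro d
    funext i
    have := congrArg (Int.cast : ℤ → ZMod Λ) (hdiff d i)
    simpa [torusCast] using this
  refine ⟨fun d => torusCast Λ (u d), fun d => torusCast Λ (v d), hab, fun d hd => ?_⟩
  have hshort : ∀ d ∈ torusShell Λ z μ, ∀ P, (P = u d ∨ P = v d) →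
      4 * ((∑ i, P i ^ 2 : ℤ) : ℝ) ≤ z + (μ + z / 2) + Λ := by
    intro d hd P hP
    have h1 : 4 * ∑ i, P i ^ 2 ≤ z + torusSq d + 2 * ((Λ / 2 : ℕ) : ℤ) := by
      rcases hP with rfl | rfl
      · exact hu d
      · exact hv d
    have h2 : 4 * ∑ i, P i ^ 2 ≤ z + torusSq d + Λ := by omega
    have h3 : 4 * ((∑ i, P i ^ 2 : ℤ) : ℝ) ≤ z + torusSq d + Λ := by exact_mod_cast h2
    have h4 := (abs_le.1 (mem_torusShell.1 hd)).2
    linarith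
  let E : Finset (Fin z → ZMod Λ) :=
    (Fintype.piFinset fun _ : Fin z => Finset.Icc (-1 : ℤ) 1).image (torusCast Λ)
  let B : Finset (Fin z → ZMod Λ) := (latticeBall z).image (torusCast Λ)
  -- Candidates for the endpoint p' of a conflicting edge: p itself, or a point of the small ball
  -- around -p.
  let bases : Finset (Fin z → ZMod Λ) :=
    ({torusCast Λ (u d), torusCast Λ (v d)} : Finset (Fin z → ZMod Λ)).biUnion fun p =>
      insert p (B.image fun s => s - p)
  have hE : E.card ≤ 3 ^ z := Finset.card_image_le.trans (by simp)
  have hB : B.card ≤ 24 ^ z := Finset.card_image_le.trans (card_latticeBall_le z)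
  have hbases : bases.card ≤ 2 * (24 ^ z + 1) := by
    calc bases.card ≤ ({torusCast Λ (u d), torusCast Λ (v d)} : Finset _).card * (24 ^ z + 1) :=
          Finset.card_biUnion_le_card_mul _ _ _ fun p _ =>
            (Finset.card_insert_le _ _).trans
              (Nat.add_le_add_right (Finset.card_image_le.trans hB) 1)
      _ ≤ _ := Nat.mul_le_mul_right _ Finset.card_le_two
  have hsub : (torusShell Λ z μ).filter (EdgeConflict (fun d => torusCast Λ (u d))
      (fun d => torusCast Λ (v d)) (torusShell Λ z μ) d) ⊆
      (bases ×ˢ E).image (fun pe => pe.2 - (pe.1 + pe.1)) ∪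
        (bases ×ˢ E).image (fun pe => pe.1 + pe.1 - pe.2) := by
    intro d' hd'
    obtain ⟨hd', p, hp, p', hp', hpp⟩ := Finset.mem_filter.1 hd'
    have hmem : p ∈ ({torusCast Λ (u d), torusCast Λ (v d)} : Finset (Fin z → ZMod Λ)) := by
      simpa using hp
    have hbase : p' ∈ bases := by
      refine Finset.mem_biUnion.2 ⟨p, hmem, ?_⟩
      rcases hpp with rfl | hpp
      · exact Finset.mem_insert_self _ _
      refine Finset.mem_insert_of_mem ?_
      obtain ⟨P, hP, rfl⟩ : ∃ P, (P = u d ∨ P = v d) ∧ p = torusCast Λ P := by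
        rcases hp with h | h
        · exact ⟨_, .inl rfl, h⟩
        · exact ⟨_, .inr rfl, h⟩
      obtain ⟨P', hP', rfl⟩ : ∃ P, (P = u d' ∨ P = v d') ∧ p' = torusCast Λ P := by
        rcases hp' with h | h
        · exact ⟨_, .inl rfl, h⟩
        · exact ⟨_, .inr rfl, h⟩
      refine Finset.mem_image.2 ⟨torusCast Λ (fun i => P' i + P i),
        Finset.mem_image_of_mem _ (mem_latticeBall.2 ?_), ?_⟩
      · have h1 := hshort d hd P hP
        have h2 := hshort d' hd' P' hP'
        have h3 : (torusSq (torusCast Λ P' - torusCast Λ P) : ℝ) ≤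
            ((∑ i, (P' i - P i) ^ 2 : ℤ) : ℝ) := by
          have := torusSq_torusCast_le (Λ := Λ) fun i => P' i - P i
          rw [show torusCast Λ P' - torusCast Λ P = torusCast Λ fun i => P' i - P i by
            funext i; simp [torusCast]]
          exact_mod_cast this
        have h4 := (abs_le.1 (mem_torusShell.1 hpp)).1
        -- Parallelogram law. The two terms on the right add up to at most μ + 3z/2 + Λ, and |P' -
        -- P|² is at least μ - z/2, which leaves 2z + Λ ≤ 3z.
        have h5 : ∑ i, (P' i + P i) ^ 2 + ∑ i, (P' i - P i) ^ 2 =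
            2 * ∑ i, P i ^ 2 + 2 * ∑ i, P' i ^ 2 := by
          rw [Finset.mul_sum, Finset.mul_sum, ← Finset.sum_add_distrib, ← Finset.sum_add_distrib]
          exact Finset.sum_congr rfl fun i _ => by ring
        have h6 : ((∑ i, (P' i + P i) ^ 2 : ℤ) : ℝ) + ((∑ i, (P' i - P i) ^ 2 : ℤ) : ℝ) =
            2 * ((∑ i, P i ^ 2 : ℤ) : ℝ) + 2 * ((∑ i, P' i ^ 2 : ℤ) : ℝ) := by exact_mod_cast h5
        have h7 : (Λ : ℝ) ≤ z := by exact_mod_cast hz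
        have h8 : ((∑ i, (P' i + P i) ^ 2 : ℤ) : ℝ) ≤ 3 * z := by linarith
        exact_mod_cast h8
      · funext i
        simp [torusCast]
    have he : torusCast Λ (u d') + torusCast Λ (v d') ∈ E := by
      refine Finset.mem_image.2 ⟨fun i => u d' i + v d' i, ?_, by funext i; simp [torusCast]⟩
      rw [Fintype.mem_piFinset]
      intro i
      rw [Finset.mem_Icc]
      exact abs_le.1 (hsum d' i)
    rw [Finset.mem_union]
    -- With e = u d' + v d' in {-1, 0, 1}^z, the difference d' is e - 2p' if p' comes from u, and
    -- 2p' - e if it comes from v.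
    rcases hp' with rfl | rfl
    · refine .inl (Finset.mem_image.2 ⟨(_, _), Finset.mk_mem_product hbase he, ?_⟩)
      conv_rhs => rw [← hab d']
      simp only
      abel
    · refine .inr (Finset.mem_image.2 ⟨(_, _), Finset.mk_mem_product hbase he, ?_⟩)
      conv_rhs => rw [← hab d']
      simp only
      abel
  have hprod : (bases ×ˢ E).card ≤ 2 * (24 ^ z + 1) * 3 ^ z := by
    rw [Finset.card_product]
    exact Nat.mul_le_mul hbases hE
  calc _ ≤ _ := Finset.card_le_card hsub
    _ ≤ 2 * (24 ^ z + 1) * 3 ^ z + 2 * (24 ^ z + 1) * 3 ^ z :=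
        (Finset.card_union_le _ _).trans (Nat.add_le_add (Finset.card_image_le.trans hprod)
          (Finset.card_image_le.trans hprod))
    _ ≤ 2 * (24 ^ z + 24 ^ z) * 3 ^ z + 2 * (24 ^ z + 24 ^ z) * 3 ^ z := by
        have : 1 ≤ 24 ^ z := Nat.one_le_pow _ _ (by norm_num)
        gcongr
    _ = 8 * 72 ^ z := by
        rw [show 72 = 24 * 3 by norm_num, mul_pow]
        ring

/-- A symmetric set contains one element of each pair `{d, -d}` with `d ≠ -d`. -/
theorem exists_half {A : Type*} [AddCommGroup A] [Fintype A] [DecidableEq A] (X : Finset A)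
    (hX : ∀ d, -d ∈ X ↔ d ∈ X) :
    ∃ H ⊆ X, (∀ d ∈ H, ∀ d' ∈ H, d ≠ -d') ∧ 2 * H.card ≤ Fintype.card A ∧
      X.card ≤ 2 * H.card + (Finset.univ.filter fun d : A => d = -d).card := by
  let e := Fintype.equivFin A
  -- An arbitrary enumeration of the group selects one of d and -d; the strict inequality excludes d
  -- = -d.
  let H := X.filter fun d => e d < e (-d)
  have hH : ∀ d ∈ H, ∀ d' ∈ H, d ≠ -d' := by
    rintro d hd d' hd' rfl
    have h1 := (Finset.mem_filter.1 hd).2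
    have h2 := (Finset.mem_filter.1 hd').2
    rw [neg_neg] at h1
    exact lt_asymm h1 h2
  have hneg : (H.image fun d => -d).card = H.card :=
    Finset.card_image_of_injective _ neg_injective
  refine ⟨H, Finset.filter_subset _ _, hH, ?_, ?_⟩
  · have hdisj : Disjoint H (H.image fun d => -d) := by
      rw [Finset.disjoint_left]
      intro d hd hd'
      obtain ⟨d', hd'H, rfl⟩ := Finset.mem_image.1 hd'
      exact hH _ hd _ hd'H rfl
    rw [two_mul]
    nth_rewrite 2 [← hneg]
    rw [← Finset.card_union_of_disjoint hdisj]
    exact Finset.card_le_univ _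
  · have : X ⊆ (H ∪ H.image fun d => -d) ∪ Finset.univ.filter fun d : A => d = -d := by
      intro d hd
      rw [Finset.mem_union, Finset.mem_union]
      rcases lt_trichotomy (e d) (e (-d)) with h | h | h
      · exact .inl (.inl (Finset.mem_filter.2 ⟨hd, h⟩))
      · exact .inr (Finset.mem_filter.2 ⟨Finset.mem_univ _, e.injective h⟩)
      · refine .inl (.inr (Finset.mem_image.2 ⟨-d, Finset.mem_filter.2 ⟨(hX d).2 hd, ?_⟩, ?_⟩))
        · rwa [neg_neg]
        · rw [neg_neg]
    have h1 := Finset.card_le_card this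
    have h2 := Finset.card_union_le (H ∪ H.image fun d => -d)
      (Finset.univ.filter fun d : A => d = -d)
    have h3 := Finset.card_union_le H (H.image fun d => -d)
    omega

/-- A residue equal to its negative is 0 or Λ/2, so each coordinate has at most two choices. -/
theorem card_torus_eq_neg_le [NeZero Λ] :
    (Finset.univ.filter fun d : Fin z → ZMod Λ => d = -d).card ≤ 2 ^ z := by
  have hsub : (Finset.univ.filter fun d : Fin z → ZMod Λ => d = -d) ⊆
      Fintype.piFinset fun _ => ({0, ((Λ / 2 : ℕ) : ZMod Λ)} : Finset (ZMod Λ)) := by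
    intro d hd
    rw [Fintype.mem_piFinset]
    intro i
    have h : -(d i) = d i := (congrFun (Finset.mem_filter.1 hd).2 i).symm
    rw [Finset.mem_insert, Finset.mem_singleton]
    refine ((ZMod.neg_eq_self_iff _).1 h).imp id fun h => ?_
    rw [show Λ / 2 = (d i).val by omega, ZMod.natCast_zmod_val]
  calc _ ≤ _ := Finset.card_le_card hsub
    _ = (({0, ((Λ / 2 : ℕ) : ZMod Λ)} : Finset (ZMod Λ)).card) ^ z := by simp
    _ ≤ 2 ^ z := Nat.pow_le_pow_left Finset.card_le_two _

end Torus

/-! ### Concentration of the squared length -/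

section Tail

open Classical in
/-- A Chernoff bound for the sum of a bounded centred function over the coordinates of a uniform
random vector. -/
theorem card_lt_sum_le {α : Type*} [Fintype α] (z : ℕ) {X : α → ℝ} (hX : ∑ a, X a = 0) {b t l : ℝ}
    (hb : ∀ a, |X a| ≤ b) (ht : 0 ≤ t) (htb : t * b ≤ 1) :
    ((Finset.univ.filter fun d : Fin z → α => l < ∑ i, X (d i)).card : ℝ) ≤
      (Fintype.card α : ℝ) ^ z * Real.exp (z * (t * b) ^ 2 - t * l) := by
  have hone : ∑ a, Real.exp (t * X a) ≤ Fintype.card α * Real.exp ((t * b) ^ 2) := by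
    -- Use exp y ≤ 1 + y + y² for |y| ≤ 1; the linear term has mean zero.
    calc ∑ a, Real.exp (t * X a) ≤ ∑ a, (t * X a + Real.exp ((t * b) ^ 2)) := by
          refine Finset.sum_le_sum fun a _ => ?_
          have h1 : |t * X a| ≤ t * b := by
            rw [abs_mul, abs_of_nonneg ht]
            exact mul_le_mul_of_nonneg_left (hb a) ht
          have h2 := (abs_le.1 (Real.abs_exp_sub_one_sub_id_le (h1.trans htb))).2
          have h3 : (t * X a) ^ 2 ≤ (t * b) ^ 2 := by
            rw [← sq_abs]
            gcongr
          have h4 := Real.add_one_le_exp ((t * b) ^ 2)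
          linarith
      _ = _ := by
          rw [Finset.sum_add_distrib, ← Finset.mul_sum, hX]
          simp
  calc ((Finset.univ.filter fun d : Fin z → α => l < ∑ i, X (d i)).card : ℝ)
      = ∑ d ∈ Finset.univ.filter fun d : Fin z → α => l < ∑ i, X (d i), (1 : ℝ) := by simp
    _ ≤ ∑ d ∈ Finset.univ.filter fun d : Fin z → α => l < ∑ i, X (d i),
          Real.exp (-(t * l)) * ∏ i, Real.exp (t * X (d i)) := by
        refine Finset.sum_le_sum fun d hd => ?_
        have hd := (Finset.mem_filter.1 hd).2
        rw [← Real.exp_sum, ← Real.exp_add, ← Finset.mul_sum]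
        refine Real.one_le_exp ?_
        nlinarith
    _ ≤ ∑ d : Fin z → α, Real.exp (-(t * l)) * ∏ i, Real.exp (t * X (d i)) :=
        Finset.sum_le_sum_of_subset_of_nonneg (Finset.filter_subset _ _)
          fun _ _ _ => by positivity
    _ = Real.exp (-(t * l)) * (∑ a, Real.exp (t * X a)) ^ z := by
        have := Finset.prod_univ_sum (fun _ : Fin z => (Finset.univ : Finset α))
          fun _ a => Real.exp (t * X a)
        rw [← Finset.mul_sum, ← Fintype.piFinset_univ, ← this, Finset.prod_const, Finset.card_fin]
    _ ≤ Real.exp (-(t * l)) * (Fintype.card α * Real.exp ((t * b) ^ 2)) ^ z := by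
        gcongr
    _ = _ := by
        rw [mul_pow, ← Real.exp_nat_mul, sub_eq_add_neg, Real.exp_add]
        ring

/-- Almost all vectors of the torus lie in the shell around the mean squared length. -/
theorem exists_card_torusShell_ge (Λ z : ℕ) [NeZero Λ] : ∃ μ : ℝ,
    (Λ : ℝ) ^ z - 2 * (Λ : ℝ) ^ z * Real.exp (-(z / (Λ : ℝ) ^ 4)) ≤ (torusShell Λ z μ).card := by
  classical
  have hΛ : (1 : ℝ) ≤ Λ := by exact_mod_cast NeZero.one_le
  let f : ZMod Λ → ℝ := fun a => ((a.valMinAbs ^ 2 : ℤ) : ℝ)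
  have hf : ∀ a, 0 ≤ f a ∧ f a ≤ (Λ : ℝ) ^ 2 / 4 := by
    intro a
    have h1 : |(a.valMinAbs : ℝ)| ≤ Λ / 2 := by
      have := ZMod.natAbs_valMinAbs_le a
      have h2 : ((a.valMinAbs.natAbs : ℕ) : ℝ) * 2 ≤ Λ := by
        exact_mod_cast (show a.valMinAbs.natAbs * 2 ≤ Λ by omega)
      rw [Nat.cast_natAbs, Int.cast_abs] at h2
      linarith
    have h3 : f a = |(a.valMinAbs : ℝ)| ^ 2 := by simp [f]
    rw [h3]
    exact ⟨by positivity, by nlinarith [abs_nonneg (a.valMinAbs : ℝ)]⟩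
  let m : ℝ := (∑ a, f a) / Λ
  have hsum : ∑ a, f a = Λ * m := by
    simp only [m]
    field_simp
  have hm0 : 0 ≤ m := div_nonneg (Finset.sum_nonneg fun a _ => (hf a).1) (by linarith)
  have hm1 : m ≤ (Λ : ℝ) ^ 2 / 4 := by
    have : ∑ a, f a ≤ ∑ _a : ZMod Λ, (Λ : ℝ) ^ 2 / 4 := Finset.sum_le_sum fun a _ => (hf a).2
    rw [hsum, Finset.sum_const, Finset.card_univ, ZMod.card, nsmul_eq_mul] at this
    exact le_of_mul_le_mul_left this (by linarith)
  have hΛ4 : (1 : ℝ) ≤ (Λ : ℝ) ^ 4 := one_le_pow₀ hΛ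
  have htail : ∀ σ : ℝ, |σ| = 1 →
      ((Finset.univ.filter fun d : Fin z → ZMod Λ => (z : ℝ) / 2 < ∑ i, σ * (f (d i) - m)).card : ℝ)
        ≤ (Λ : ℝ) ^ z * Real.exp (-(z / (Λ : ℝ) ^ 4)) := by
    intro σ hσ
    -- The squares lie in [0, Λ²/4], whence b. The choice t = 4/Λ⁴ makes tb = 1/Λ² and the exponent
    -- z/Λ⁴ - 2z/Λ⁴.
    have := card_lt_sum_le z (X := fun a => σ * (f a - m)) (b := (Λ : ℝ) ^ 2 / 4)
      (t := 4 / (Λ : ℝ) ^ 4) (l := z / 2) ?_ ?_ (by positivity) ?_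
    · rw [ZMod.card] at this
      refine this.trans (le_of_eq ?_)
      congr 2
      field_simp
      ring
    · rw [← Finset.mul_sum, Finset.sum_sub_distrib, hsum]
      simp
    · intro a
      rw [abs_mul, hσ, one_mul, abs_le]
      constructor <;> linarith [(hf a).1, (hf a).2]
    · rw [show 4 / (Λ : ℝ) ^ 4 * ((Λ : ℝ) ^ 2 / 4) = 1 / (Λ : ℝ) ^ 2 by field_simp]
      exact (div_le_one (by positivity)).2 (one_le_pow₀ hΛ)
  refine ⟨z * m, ?_⟩
  have hcompl : (torusShell Λ z (z * m))ᶜ ⊆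
      (Finset.univ.filter fun d : Fin z → ZMod Λ => (z : ℝ) / 2 < ∑ i, 1 * (f (d i) - m)) ∪
      (Finset.univ.filter fun d : Fin z → ZMod Λ => (z : ℝ) / 2 < ∑ i, (-1) * (f (d i) - m)) := by
    intro d hd
    rw [Finset.mem_compl, mem_torusShell, not_le, lt_abs] at hd
    have hs : ∑ i, (f (d i) - m) = torusSq d - z * m := by
      simp [f, torusSq, Finset.sum_sub_distrib]
    rw [Finset.mem_union, Finset.mem_filter, Finset.mem_filter, ← Finset.mul_sum, ← Finset.mul_sum,
      hs, one_mul, neg_one_mul]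
    exact hd.imp (fun h => ⟨Finset.mem_univ _, h⟩) fun h => ⟨Finset.mem_univ _, h⟩
  have h1 : (((torusShell Λ z (z * m))ᶜ).card : ℝ) ≤
      2 * (Λ : ℝ) ^ z * Real.exp (-(z / (Λ : ℝ) ^ 4)) := by
    have h2 := (Finset.card_le_card hcompl).trans (Finset.card_union_le _ _)
    have h3 := htail 1 (by norm_num)
    have h4 := htail (-1) (by norm_num)
    have h5 := (Nat.cast_le (α := ℝ)).2 h2
    push_cast at h5
    linarith
  have h2 : ((torusShell Λ z (z * m)).card : ℝ) + ((torusShell Λ z (z * m))ᶜ).card = (Λ : ℝ) ^ z := by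
    have := Finset.card_add_card_compl (torusShell Λ z (z * m))
    rw [Fintype.card_pi] at this
    simp only [ZMod.card, Finset.prod_const, Finset.card_univ, Fintype.card_fin] at this
    exact_mod_cast this
  linarith

end Tail

/-! ### Choice of parameters and the dense graphs -/

theorem exists_not_eq_neg {Λ z : ℕ} [NeZero Λ] (hΛ : 2 < Λ) (hz : 0 < z) :
    ∃ d : Fin z → ZMod Λ, d ≠ -d := by
  by_contra! h
  have h1 := card_torus_eq_neg_le (Λ := Λ) (z := z)
  rw [Finset.filter_true_of_mem fun d _ => h d, Finset.card_univ, Fintype.card_pi] at h1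
  simp only [ZMod.card, Finset.prod_const, Finset.card_univ, Fintype.card_fin] at h1
  exact absurd h1 (not_le.2 (Nat.pow_lt_pow_left hΛ hz.ne'))

/-- The geometric decay which dominates all losses of the construction. -/
theorem pow_le_exp_mul_pow {Λ z : ℕ} {r s : ℝ} (hr : 0 ≤ r) (hs : 0 ≤ s)
    (h : r ≤ s * (1 - 3 / 4 / Λ)) : r ^ z ≤ Real.exp (-(3 / 4 / Λ * z)) * s ^ z := by
  have h1 : r ≤ Real.exp (-(3 / 4 / Λ)) * s := by
    have h2 := Real.add_one_le_exp (-(3 / 4 / (Λ : ℝ)))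
    calc r ≤ s * (1 - 3 / 4 / Λ) := h
      _ ≤ s * Real.exp (-(3 / 4 / Λ)) := by gcongr; linarith
      _ = _ := mul_comm _ _
  calc r ^ z ≤ (Real.exp (-(3 / 4 / Λ)) * s) ^ z := by gcongr
    _ = _ := by
      rw [mul_pow, ← Real.exp_nat_mul]
      congr 2
      ring

/-- The assumption forces z ≥ Λ⁴, and then the exponent 3z/(4Λ) exceeds z/(2Λ⁴) by at least 100. -/
theorem hundred_mul_exp_le {Λ z : ℕ} (hΛ : 111 ≤ Λ)
    (hx : Real.exp (-(z / (2 * (Λ : ℝ) ^ 4))) ≤ 1 / 2) :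
    100 * Real.exp (-(3 / 4 / Λ * z)) ≤ Real.exp (-(z / (2 * (Λ : ℝ) ^ 4))) := by
  have hL : (111 : ℝ) ≤ Λ := by exact_mod_cast hΛ
  have hL0 : (0 : ℝ) < Λ := by linarith
  have hw : 1 / 2 ≤ z / (2 * (Λ : ℝ) ^ 4) := by
    have := Real.add_one_le_exp (-(z / (2 * (Λ : ℝ) ^ 4)))
    linarith
  have hz : (Λ : ℝ) ^ 4 ≤ z := by
    rw [le_div_iff₀ (by positivity)] at hw
    linarith
  have hexp : 100 ≤ 3 / 4 / Λ * z - z / (2 * (Λ : ℝ) ^ 4) := by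
    have h1 : 3 / 4 / Λ * z - z / (2 * (Λ : ℝ) ^ 4) =
        z * ((3 / 4 * Λ ^ 3 - 1 / 2) / (Λ : ℝ) ^ 4) := by
      field_simp
    have h3 : (111 : ℝ) ^ 3 ≤ (Λ : ℝ) ^ 3 := by gcongr
    have h2 : 100 ≤ 3 / 4 * (Λ : ℝ) ^ 3 - 1 / 2 := by
      norm_num at h3
      linarith
    rw [h1]
    calc (100 : ℝ) ≤ 3 / 4 * Λ ^ 3 - 1 / 2 := h2
      _ = (Λ : ℝ) ^ 4 * ((3 / 4 * Λ ^ 3 - 1 / 2) / (Λ : ℝ) ^ 4) := by field_simp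
      _ ≤ _ := by gcongr
  calc 100 * Real.exp (-(3 / 4 / Λ * z))
      ≤ Real.exp (3 / 4 / Λ * z - z / (2 * (Λ : ℝ) ^ 4)) * Real.exp (-(3 / 4 / Λ * z)) := by
        gcongr
        have := Real.add_one_le_exp (3 / 4 / Λ * z - z / (2 * (Λ : ℝ) ^ 4))
        linarith
    _ = _ := by
        rw [← Real.exp_add]
        congr 1
        ring

/-- The consequences for the matching size `γ` and the degree `2 q γ` of choosing `q` disjoint
matchings of size `γ = ⌊E / (q + q₀)⌋` among nearly `N / 2` edges. -/
theorem matching_size_bounds {N Q x y q q₀ γ E : ℝ} (hx0 : 0 < x) (hx : x ≤ 1 / 2) (hy0 : 0 < y)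
    (hyx : 100 * y ≤ x) (hN : 0 < N) (hQ : 1 ≤ Q) (hQN : Q ≤ y * N) (hqQ : Q ≤ q) (hq : q ≤ 2 * Q)
    (hq₀ : 0 ≤ q₀) (hq₀Q : q₀ ≤ 9 * (y * Q)) (hγ : 0 ≤ γ) (hγE : (q + q₀) * γ ≤ E)
    (hEγ : E ≤ (q + q₀) * (γ + 1)) (hE : 2 * E ≤ N) (hE' : N - 2 * N * x ^ 2 - Q ≤ 2 * E) :
    2 * γ * Q ≤ N ∧ N ≤ 40 * γ * Q ∧ N - 2 * (q * γ) ≤ 2 * x * N := by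
  have hyN : 100 * (y * N) ≤ x * N := by
    rw [← mul_assoc]
    gcongr
  have hxN : x * N ≤ N / 2 := by
    calc x * N ≤ 1 / 2 * N := by gcongr
      _ = N / 2 := by ring
  have hxxN : 2 * N * x ^ 2 ≤ x * N := by
    calc 2 * N * x ^ 2 = 2 * x * (x * N) := by ring
      _ ≤ 1 * (x * N) := by gcongr; linarith
      _ = x * N := one_mul _
  have hγQ : 2 * γ * Q ≤ N := by
    have : Q * γ ≤ (q + q₀) * γ := by gcongr; linarith
    linarith
  have hq₀' : q₀ ≤ Q := by
    calc q₀ ≤ 9 * y * Q := by linarith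
      _ ≤ 1 * Q := by gcongr; linarith
      _ = Q := one_mul _
  refine ⟨hγQ, ?_, ?_⟩
  · have h1 : (q + q₀) * (γ + 1) ≤ 3 * Q * (γ + 1) := by gcongr; linarith
    linarith
  -- What is lost consists of the vectors outside the shell and the self-inverse ones, the q₀γ
  -- differences the greedy choice may leave over, and the rounding of γ. The first loss is at most
  -- xN, all others are O(yN).
  · have h1 : q₀ * γ ≤ 5 * (y * N) := by
      calc q₀ * γ ≤ 9 * (y * Q) * γ := by gcongr
        _ = 9 / 2 * y * (2 * γ * Q) := by ring
        _ ≤ 9 / 2 * y * N := by gcongr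
        _ ≤ _ := by linarith [mul_pos hy0 hN]
    linarith [mul_pos hx0 hN]

/-- For `N = Λ ^ z`, `Q = 10.5 ^ (2 z)` and `x = exp (-z / (2 Λ⁴))`, there are Ruzsa-Szemerédi graphs
on `N` vertices of minimum degree at least `N - 2 x N`.  As soon as this degree condition is not
void they have `N ⌈Q⌉` matchings with between `N / (40 Q)` and `N / (2 Q)` edges. -/
theorem exists_dense_rsGraph {Λ z : ℕ} (hΛ : 111 ≤ Λ) (hz : 2 * Λ ≤ z) :
    ∃ (γ τ : ℕ) (G : SimpleGraph (Fin (Λ ^ z))) (𝓜 : Fin τ → G.Subgraph),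
      0 < γ ∧ 0 < τ ∧ IsRSDecomposition G γ 𝓜 ∧
      (∀ u, (Λ : ℝ) ^ z - (G.neighborSet u).ncard ≤
        2 * Real.exp (-(z / (2 * (Λ : ℝ) ^ 4))) * (Λ : ℝ) ^ z) ∧
      (Real.exp (-(z / (2 * (Λ : ℝ) ^ 4))) ≤ 1 / 2 →
        τ = Λ ^ z * ⌈(110.25 : ℝ) ^ z⌉₊ ∧ 2 * γ * (110.25 : ℝ) ^ z ≤ (Λ : ℝ) ^ z ∧
        (Λ : ℝ) ^ z ≤ 40 * γ * (110.25 : ℝ) ^ z) := by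
  classical
  have : NeZero Λ := ⟨by omega⟩
  have hcardA : Fintype.card (Fin z → ZMod Λ) = Λ ^ z := by
    rw [Fintype.card_pi]
    simp [ZMod.card]
  let φ : Fin (Λ ^ z) ≃ (Fin z → ZMod Λ) := (Fintype.equivFinOfCardEq hcardA).symm
  have hN0 : 0 < Λ ^ z := Nat.pow_pos (by omega)
  have hN0' : (0 : ℝ) < (Λ : ℝ) ^ z := by exact_mod_cast hN0
  set x := Real.exp (-(z / (2 * (Λ : ℝ) ^ 4))) with hxdef
  rcases lt_or_ge (1 / 2) x with hx | hx
  -- For x > 1/2 the degree bound exceeds N and is void, so a single difference with one-edge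
  -- matchings suffices.
  · obtain ⟨d, hd⟩ := exists_not_eq_neg (Λ := Λ) (z := z) (by omega) (by omega)
    have hS : ∀ e ∈ ⋃ _ : Fin 1, ((({d} : Finset (Fin z → ZMod Λ))) : Set (Fin z → ZMod Λ)),
        ∀ e' ∈ ⋃ _ : Fin 1, ((({d} : Finset (Fin z → ZMod Λ))) : Set (Fin z → ZMod Λ)),
          e ≠ -e' := by
      simpa using hd
    obtain ⟨𝓜, h𝓜⟩ := isRSDecomposition_cayleyGraph φ (γ := 1) (fun _ : Fin 1 => {d})
      (fun _ => 0) id (fun d => sub_zero d) (fun _ => rfl)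
      (fun i j hij => absurd (Subsingleton.elim i j) hij) hS
      (fun j e he e' he' hne => absurd
        ((Finset.mem_singleton.1 he).trans (Finset.mem_singleton.1 he').symm) hne)
    refine ⟨1, _, _, 𝓜, one_pos, by omega, h𝓜, fun u => ?_, fun h => absurd h (not_le.2 hx)⟩
    have h1 : (0 : ℝ) ≤ (((cayleyGraph φ _ hS).neighborSet u).ncard : ℝ) := Nat.cast_nonneg _
    nlinarith
  · set N : ℝ := (Λ : ℝ) ^ z with hN
    set Q : ℝ := (110.25 : ℝ) ^ z with hQ
    set y := Real.exp (-(3 / 4 / Λ * z)) with hy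
    have hL : (111 : ℝ) ≤ Λ := by exact_mod_cast hΛ
    have hL0 : (0 : ℝ) < Λ := by linarith
    have hyx : 100 * y ≤ x := hundred_mul_exp_le hΛ hx
    have hy0 : 0 < y := Real.exp_pos _
    have hQN : Q ≤ y * N := by
      -- The constant 3/4 is 111 - 110.25: the required inequality 110.25 ≤ Λ - 3/4 is an equality
      -- at Λ = 111.
      refine pow_le_exp_mul_pow (by norm_num) hL0.le ?_
      rw [mul_sub, mul_one, mul_div_cancel₀ _ hL0.ne']
      norm_num
      linarith
    have h72 : (72 : ℝ) ^ z ≤ y * Q := by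
      refine pow_le_exp_mul_pow (by norm_num) (by norm_num) ?_
      have : 3 / 4 / (Λ : ℝ) ≤ 3 / 4 / 111 := by gcongr
      norm_num at this ⊢
      linarith
    have h2 : (2 : ℝ) ^ z ≤ Q := pow_le_pow_left₀ (by norm_num) (by norm_num) z
    have hQ1 : 1 ≤ Q := one_le_pow₀ (by norm_num)
    have h721 : (1 : ℝ) ≤ 72 ^ z := one_le_pow₀ (by norm_num)
    obtain ⟨μ, hμ⟩ := exists_card_torusShell_ge Λ z
    obtain ⟨a, b, hab, hconf⟩ := exists_edges_few_conflicts (show Λ ≤ z by omega) μ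
    obtain ⟨H, hHX, hHneg, hHle, hHge⟩ := exists_half (torusShell Λ z μ)
      fun d => neg_mem_torusShell
    set q := ⌈Q⌉₊ with hq
    have hqle : (q : ℝ) ≤ 2 * Q := by
      have := Nat.ceil_lt_add_one (show 0 ≤ Q by linarith)
      linarith
    have hqge : Q ≤ q := Nat.le_ceil _
    -- One more than the conflict degree, as the greedy choice needs (q + Δ + 1)γ elements.
    set q₀ := 8 * 72 ^ z + 1 with hq₀
    have hq₀le : (q₀ : ℝ) ≤ 9 * (y * Q) := by
      rw [hq₀]
      push_cast
      linarith
    have hqq : 0 < q + q₀ := by omega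
    set γ := H.card / (q + q₀) with hγ
    have hγ1 : (q + q₀) * γ ≤ H.card := Nat.mul_div_le _ _
    have hγ2 : H.card < (q + q₀) * (γ + 1) := Nat.lt_mul_div_succ _ hqq
    have hγ1' : ((q : ℝ) + q₀) * γ ≤ H.card := by exact_mod_cast hγ1
    have hγ2' : (H.card : ℝ) ≤ (q + q₀) * (γ + 1) := by exact_mod_cast hγ2.le
    have hHle' : 2 * (H.card : ℝ) ≤ N := by
      rw [hcardA] at hHle
      rw [hN]
      exact_mod_cast hHle
    have hHge' : N - 2 * N * x ^ 2 - Q ≤ 2 * H.card := by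
      have h1 := hHge.trans (Nat.add_le_add_left card_torus_eq_neg_le _)
      have h3 : ((torusShell Λ z μ).card : ℝ) ≤ 2 * H.card + 2 ^ z := by exact_mod_cast h1
      have h4 : Real.exp (-(z / (Λ : ℝ) ^ 4)) = x ^ 2 := by
        rw [hxdef, ← Real.exp_nat_mul]
        congr 1
        field_simp
        norm_num
      rw [h4] at hμ
      linarith
    have hx0 : 0 < x := Real.exp_pos _
    have hγ0 : (0 : ℝ) ≤ γ := Nat.cast_nonneg _
    obtain ⟨hγQ, hNγ, hdeg⟩ := matching_size_bounds hx0 hx hy0 hyx hN0' hQ1 hQN hqge hqle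
      (Nat.cast_nonneg _) hq₀le hγ0 hγ1' hγ2' hHle' hHge'
    have hγpos : 0 < γ := by
      rcases Nat.eq_zero_or_pos γ with h | h
      · rw [h] at hNγ
        norm_num at hNγ
        linarith
      · exact h
    obtain ⟨C, hCH, hCcard, hCdisj, hCind⟩ := exists_disjoint_independent
      (conf := EdgeConflict a b (torusShell Λ z μ)) (Δ := 8 * 72 ^ z)
      (fun d d' h => h.symm fun d => neg_mem_torusShell) γ q H
      (fun d hd => (Finset.card_le_card (Finset.filter_subset_filter _ hHX)).trans
        (hconf d (hHX hd))) hγ1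
    have hSH : ⋃ j, (C j : Set (Fin z → ZMod Λ)) ⊆ H :=
      Set.iUnion_subset fun j => Finset.coe_subset.2 (hCH j)
    have hS : ∀ d ∈ ⋃ j, (C j : Set (Fin z → ZMod Λ)), ∀ d' ∈ ⋃ j, (C j : Set (Fin z → ZMod Λ)),
        d ≠ -d' := fun d hd d' hd' => hHneg d (hSH hd) d' (hSH hd')
    obtain ⟨𝓜, h𝓜⟩ := isRSDecomposition_cayleyGraph φ C a b hab hCcard hCdisj hS
      (fun j d hd d' hd' hdd p hp p' hp' =>
        ⟨fun h => hCind j d hd d' hd' hdd ⟨p, hp, p', hp', .inl h⟩,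
          fun h => hCind j d hd d' hd' hdd ⟨p, hp, p', hp', .inr (hHX (hSH h))⟩⟩)
    have hqpos : 0 < q := by
      have : (0 : ℝ) < q := by linarith
      exact_mod_cast this
    refine ⟨γ, _, _, 𝓜, hγpos, Nat.mul_pos hN0 hqpos, h𝓜, fun u => ?_, fun _ => ⟨rfl, hγQ, hNγ⟩⟩
    have hScard : (⋃ j, (C j : Set (Fin z → ZMod Λ))).ncard = q * γ := by
      have : (⋃ j, (C j : Set (Fin z → ZMod Λ))) = (Finset.univ.biUnion C : Finset _) := by simp
      rw [this, Set.ncard_coe_finset, Finset.card_biUnion fun i _ j _ hij => hCdisj i j hij]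
      simp [hCcard]
    rw [ncard_neighborSet_cayleyGraph, hScard]
    push_cast
    exact hdeg

/-! ### Asymptotics of throughput and packet number -/

theorem rpow_neg_rsDelta {Λ : ℕ} (hΛ : 1 < Λ) (z : ℕ) :
    ((Λ : ℝ) ^ z) ^ (-rsDelta Λ) = ((110.25 : ℝ) ^ z)⁻¹ := by
  have hL : (1 : ℝ) < Λ := by exact_mod_cast hΛ
  have hlog : Real.log Λ ≠ 0 := (Real.log_pos hL).ne'
  have h1 : Real.log ((110.25 : ℝ) ^ z) = z * (2 * Real.log 10.5) := by
    rw [Real.log_pow, show (110.25 : ℝ) = 10.5 ^ 2 by norm_num, Real.log_pow]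
    norm_num
  rw [Real.rpow_def_of_pos (by positivity), ← Real.exp_log (show (0 : ℝ) < 110.25 ^ z by positivity),
    ← Real.exp_neg, h1, Real.log_pow, rsDelta]
  congr 1
  field_simp

theorem rsMemory_eq {Λ : ℕ} (hΛ : 1 < Λ) (z m : ℕ) :
    rsMemory Λ z m = 2 * m * Real.exp (-(z / (2 * (Λ : ℝ) ^ 4))) := by
  have hL : (1 : ℝ) < Λ := by exact_mod_cast hΛ
  have hlog : Real.log Λ ≠ 0 := (Real.log_pos hL).ne'
  rw [rsMemory, Real.rpow_def_of_pos (by positivity), Real.log_pow]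
  congr 2
  field_simp

/-- The throughput of a scheme with `N ⌈Q⌉` matchings of size of order `N / Q` is close to
`C / Q`. -/
theorem abs_div_rsRate_sub_le {n γ : ℕ} {C Q : ℝ} (hn : 0 < n) (hγ : 0 < γ) (hC : 0 < C)
    (hQ : 0 < Q) (hγQ : (n : ℝ) ≤ 40 * γ * Q) :
    |C / rsRate n γ (n * ⌈Q⌉₊) - C * Q⁻¹| ≤ C * (Q⁻¹ + 20 * (Q / n)) * Q⁻¹ := by
  have hn' : (0 : ℝ) < n := by exact_mod_cast hn
  have hγ' : (1 : ℝ) ≤ γ := by exact_mod_cast hγ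
  have hγ0 : (0 : ℝ) < γ := by linarith
  have hqle := (Nat.ceil_lt_add_one hQ.le).le
  have hqge : Q ≤ (⌈Q⌉₊ : ℝ) := Nat.le_ceil _
  -- The inverse rate is q⁻¹(1 - 1/(2γ)) with q = ⌈Q⌉, so the errors are the rounding of Q and the
  -- term 1/(2γ) = O(Q/n).
  have hR : C / rsRate n γ (n * ⌈Q⌉₊) = C * ((⌈Q⌉₊ : ℝ)⁻¹ - (⌈Q⌉₊ : ℝ)⁻¹ * (2 * γ : ℝ)⁻¹) := by
    have h1 : (2 * γ - 1 : ℝ) ≠ 0 := by linarith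
    have h2 : (⌈Q⌉₊ : ℝ) ≠ 0 := by linarith
    rw [rsRate]
    push_cast
    field_simp
  rw [hR]
  set q : ℝ := (⌈Q⌉₊ : ℝ)
  have hq0 : 0 < q := by linarith
  have hqQ : q⁻¹ ≤ Q⁻¹ := by gcongr
  have h1 : Q⁻¹ - q⁻¹ ≤ Q⁻¹ * Q⁻¹ := by
    calc Q⁻¹ - q⁻¹ = (q - Q) * (Q⁻¹ * q⁻¹) := by field_simp
      _ ≤ 1 * (Q⁻¹ * Q⁻¹) := by gcongr; linarith
      _ = _ := one_mul _
  have h2 : (2 * γ : ℝ)⁻¹ ≤ 20 * (Q / n) := by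
    rw [inv_le_iff_one_le_mul₀ (by positivity)]
    rw [show 20 * (Q / n) * (2 * γ) = 40 * γ * Q / n by ring, one_le_div hn']
    exact hγQ
  have h3 : q⁻¹ * (2 * γ : ℝ)⁻¹ ≤ Q⁻¹ * (20 * (Q / n)) := by gcongr
  have h4 : 0 ≤ q⁻¹ * (2 * γ : ℝ)⁻¹ := by positivity
  have h5 : 0 ≤ Q⁻¹ * Q⁻¹ := by positivity
  rw [← mul_sub, abs_mul, abs_of_pos hC, mul_assoc]
  gcongr
  rw [abs_le]
  constructor <;> nlinarith

/-- The relative error is of order 1/Q + Q/n with Q = 110.25^z and n = Λ^z; both terms vanish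
because 1 < 110.25 < Λ. -/
theorem isLittleO_throughput {Λ : ℕ} (hΛ : 111 ≤ Λ) {γ τ : ℕ → ℕ}
    (h : ∀ᶠ z in atTop, 0 < γ z ∧ τ z = Λ ^ z * ⌈(110.25 : ℝ) ^ z⌉₊ ∧
      (Λ : ℝ) ^ z ≤ 40 * γ z * (110.25 : ℝ) ^ z) {C : ℝ} (hC : 0 < C) :
    (fun z : ℕ => C / rsRate (Λ ^ z) (γ z) (τ z) - C * ((Λ : ℝ) ^ z) ^ (-rsDelta Λ)) =o[atTop]
      fun z : ℕ => ((Λ : ℝ) ^ z) ^ (-rsDelta Λ) := by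
  have hL : (111 : ℝ) ≤ Λ := by exact_mod_cast hΛ
  have ht : Tendsto (fun z : ℕ => C * (((110.25 : ℝ) ^ z)⁻¹ + 20 * ((110.25 : ℝ) ^ z / (Λ : ℝ) ^ z)))
      atTop (nhds (C * (0 + 20 * 0))) := by
    refine (Tendsto.add ?_ (Tendsto.const_mul _ ?_)).const_mul _
    · exact tendsto_inv_atTop_zero.comp (tendsto_pow_atTop_atTop_of_one_lt (by norm_num))
    · simp_rw [← div_pow]
      refine tendsto_pow_atTop_nhds_zero_of_lt_one (by positivity) ?_
      rw [div_lt_one (by linarith)]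
      norm_num
      linarith
  rw [isLittleO_iff]
  intro ε hε
  filter_upwards [h, ht.eventually_le_const (show C * (0 + 20 * 0) < ε by simpa using hε)]
    with z hz hzε
  rw [rpow_neg_rsDelta (by omega), hz.2.1, Real.norm_eq_abs,
    Real.norm_of_nonneg (by positivity)]
  have hle := abs_div_rsRate_sub_le (n := Λ ^ z) (γ := γ z) (C := C) (Q := (110.25 : ℝ) ^ z)
    (Nat.pow_pos (by omega)) hz.1 hC (by positivity) (by push_cast; exact hz.2.2)
  push_cast at hle
  exact hle.trans (by gcongr)

/-- Since 2γ ≤ n/Q, the number of packets is at most n²/Q, and Q = n^δ. -/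
theorem isBigO_packets {Λ : ℕ} (hΛ : 111 ≤ Λ) {γ : ℕ → ℕ}
    (h : ∀ᶠ z in atTop, 0 < γ z ∧ 2 * γ z * (110.25 : ℝ) ^ z ≤ (Λ : ℝ) ^ z) :
    (fun z : ℕ => (Λ : ℝ) ^ z * (2 * (γ z : ℝ) - 1)) =O[atTop]
      fun z : ℕ => ((Λ : ℝ) ^ z) ^ (2 - rsDelta Λ) := by
  have hL : (111 : ℝ) ≤ Λ := by exact_mod_cast hΛ
  have hL0 : (0 : ℝ) < Λ := by linarith
  refine IsBigO.of_bound 1 ?_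
  filter_upwards [h] with z ⟨hγ, hz⟩
  have hγ' : (1 : ℝ) ≤ γ z := by exact_mod_cast hγ
  have hN : (0 : ℝ) < (Λ : ℝ) ^ z := by positivity
  have hQ : (0 : ℝ) < (110.25 : ℝ) ^ z := by positivity
  rw [Real.norm_of_nonneg (mul_nonneg hN.le (by linarith)), one_mul,
    Real.norm_of_nonneg (by positivity), sub_eq_add_neg 2 (rsDelta Λ), Real.rpow_add hN,
    rpow_neg_rsDelta (by omega), Real.rpow_two, sq, mul_assoc]
  gcongr
  rw [← div_eq_mul_inv, le_div_iff₀ hQ]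
  nlinarith

theorem corollary3 :
    -- the scheme built on any Ruzsa-Szemerédi graph of minimum degree at least `n - n M / m`
    (∀ (n m γ τ : ℕ), 0 < m → 0 < γ → 0 < τ →
      ∀ (G : SimpleGraph (Fin n)) (𝓜 : Fin τ → G.Subgraph), IsRSDecomposition G γ 𝓜 →
      ∀ lab : Fin τ → Fin n → Fin n → Fin (2 * γ - 1), IsPacketAssignment 𝓜 lab →
      ∀ M : ℝ, (∀ u, (n : ℝ) - (G.neighborSet u).ncard ≤ n * M / m) →
      ∀ P : ProtocolModel, √2 ≤ P.range →
      ∀ pos : Fin n → EuclideanSpace ℝ (Fin 2), InUnitSquare pos →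
        AchievedBy P pos (Set.range (rsCode 𝓜 γ lab m)) M
          (rsRate n γ τ) (P.linkRate P.range / rsRate n γ τ)) ∧
    -- the asymptotic regime `n = Λ ^ z → ∞`
    (∀ Λ : ℕ, (10.5 : ℝ) ^ 2 < Λ →
      ∃ (γ τ : ℕ → ℕ) (G : ∀ z, SimpleGraph (Fin (Λ ^ z))) (𝓜 : ∀ z, Fin (τ z) → (G z).Subgraph),
        (∀ z, 2 * Λ ≤ z →
          0 < γ z ∧ 0 < τ z ∧ IsRSDecomposition (G z) (γ z) (𝓜 z) ∧
          (∀ m : ℕ, 0 < m → ∀ u, ((Λ ^ z : ℕ) : ℝ) - ((G z).neighborSet u).ncard ≤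
            ((Λ ^ z : ℕ) : ℝ) * rsMemory Λ z m / m) ∧
          (∀ m : ℕ, 0 < m →
            ∀ lab : Fin (τ z) → Fin (Λ ^ z) → Fin (Λ ^ z) → Fin (2 * γ z - 1),
            IsPacketAssignment (𝓜 z) lab →
            ∀ P : ProtocolModel, √2 ≤ P.range →
            ∀ pos : Fin (Λ ^ z) → EuclideanSpace ℝ (Fin 2), InUnitSquare pos →
              AchievedBy P pos (Set.range (rsCode (𝓜 z) (γ z) lab m)) (rsMemory Λ z m)
                (rsRate (Λ ^ z) (γ z) (τ z))
                (P.linkRate P.range / rsRate (Λ ^ z) (γ z) (τ z)))) ∧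
        (fun z : ℕ => (Λ : ℝ) ^ z * (2 * (γ z : ℝ) - 1)) =O[atTop]
          (fun z : ℕ => ((Λ : ℝ) ^ z) ^ (2 - rsDelta Λ)) ∧
        (∀ P : ProtocolModel, √2 ≤ P.range →
          (fun z : ℕ => P.linkRate P.range / rsRate (Λ ^ z) (γ z) (τ z)
              - P.linkRate P.range * ((Λ : ℝ) ^ z) ^ (-rsDelta Λ)) =o[atTop]
            (fun z : ℕ => ((Λ : ℝ) ^ z) ^ (-rsDelta Λ)) ∧
          (P.linkRate P.range = P.linkRate √2 →
            (fun z : ℕ => P.linkRate P.range / rsRate (Λ ^ z) (γ z) (τ z)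
                - P.linkRate √2 * ((Λ : ℝ) ^ z) ^ (-rsDelta Λ)) =o[atTop]
              (fun z : ℕ => ((Λ : ℝ) ^ z) ^ (-rsDelta Λ))))) := by
  refine ⟨?_, fun Λ hΛ => ?_⟩
  · intro n m γ τ hm hγ hτ G 𝓜 h lab hlab M hM P hP pos hpos
    exact achievedBy_rsCode hm hγ hτ h hlab hM hP hpos
  have hΛ' : 111 ≤ Λ := by
    have h110 : (110 : ℝ) < Λ := lt_trans (by norm_num) hΛ
    have : 110 < Λ := by exact_mod_cast h110
    omega
  have hex : ∀ z : ℕ, ∃ (γ τ : ℕ) (G : SimpleGraph (Fin (Λ ^ z))) (𝓜 : Fin τ → G.Subgraph),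
      2 * Λ ≤ z → 0 < γ ∧ 0 < τ ∧ IsRSDecomposition G γ 𝓜 ∧
      (∀ u, (Λ : ℝ) ^ z - (G.neighborSet u).ncard ≤
        2 * Real.exp (-(z / (2 * (Λ : ℝ) ^ 4))) * (Λ : ℝ) ^ z) ∧
      (Real.exp (-(z / (2 * (Λ : ℝ) ^ 4))) ≤ 1 / 2 →
        τ = Λ ^ z * ⌈(110.25 : ℝ) ^ z⌉₊ ∧ 2 * γ * (110.25 : ℝ) ^ z ≤ (Λ : ℝ) ^ z ∧
        (Λ : ℝ) ^ z ≤ 40 * γ * (110.25 : ℝ) ^ z) := by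
    intro z
    by_cases hz : 2 * Λ ≤ z
    · obtain ⟨γ, τ, G, 𝓜, h⟩ := exists_dense_rsGraph hΛ' hz
      exact ⟨γ, τ, G, 𝓜, fun _ => h⟩
    -- Dummy values below the range of z in which anything is claimed.
    · exact ⟨0, 0, ⊥, Fin.elim0, fun h => absurd h hz⟩
  choose γ τ G 𝓜 h using hex
  have hdeg : ∀ z, 2 * Λ ≤ z → ∀ m : ℕ, 0 < m → ∀ u,
      ((Λ ^ z : ℕ) : ℝ) - ((G z).neighborSet u).ncard ≤
        ((Λ ^ z : ℕ) : ℝ) * rsMemory Λ z m / m := by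
    intro z hz m hm u
    have hm' : (m : ℝ) ≠ 0 := by exact_mod_cast hm.ne'
    have := (h z hz).2.2.2.1 u
    rw [rsMemory_eq (by omega)]
    push_cast
    refine this.trans (le_of_eq ?_)
    field_simp
  have hlim : ∀ᶠ z : ℕ in atTop, Real.exp (-(z / (2 * (Λ : ℝ) ^ 4))) ≤ 1 / 2 := by
    have hpos : (0 : ℝ) < 2 * (Λ : ℝ) ^ 4 := by positivity
    have : Tendsto (fun z : ℕ => Real.exp (-((z : ℝ) / (2 * (Λ : ℝ) ^ 4)))) atTop (nhds 0) :=
      Real.tendsto_exp_neg_atTop_nhds_zero.comp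
        (tendsto_natCast_atTop_atTop.atTop_div_const hpos)
    exact this.eventually_le_const (by norm_num)
  have hlarge : ∀ᶠ z : ℕ in atTop, 0 < γ z ∧ τ z = Λ ^ z * ⌈(110.25 : ℝ) ^ z⌉₊ ∧
      2 * γ z * (110.25 : ℝ) ^ z ≤ (Λ : ℝ) ^ z ∧
      (Λ : ℝ) ^ z ≤ 40 * γ z * (110.25 : ℝ) ^ z := by
    filter_upwards [hlim, eventually_ge_atTop (2 * Λ)] with z hx hz
    exact ⟨(h z hz).1, (h z hz).2.2.2.2 hx⟩
  have hT : ∀ P : ProtocolModel,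
      (fun z : ℕ => P.linkRate P.range / rsRate (Λ ^ z) (γ z) (τ z)
          - P.linkRate P.range * ((Λ : ℝ) ^ z) ^ (-rsDelta Λ)) =o[atTop]
        (fun z : ℕ => ((Λ : ℝ) ^ z) ^ (-rsDelta Λ)) := fun P =>
    isLittleO_throughput hΛ' (hlarge.mono fun z hz => ⟨hz.1, hz.2.1, hz.2.2.2⟩)
      (P.linkRate_pos _ P.range_pos)
  refine ⟨γ, τ, G, 𝓜, fun z hz => ⟨(h z hz).1, (h z hz).2.1, (h z hz).2.2.1, hdeg z hz, ?_⟩,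
    isBigO_packets hΛ' (hlarge.mono fun z hz => ⟨hz.1, hz.2.2.1⟩), fun P _ => ⟨hT P, fun hP => ?_⟩⟩
  · intro m hm lab hlab P hP pos hpos
    exact achievedBy_rsCode hm (h z hz).1 (h z hz).2.1 (h z hz).2.2.1 hlab (hdeg z hz m hm) hP hpos
  · rw [← hP]
    exact hT P
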